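/- **Theorem (Necessary condition for weak continuity).** Let $m,n\ge 1$ and $1\le k_i\le n$ for $1\le i\le m$ be integers, let $\Lambda^{p}=\Lambda^p(\mathbb{R}^n)$ be the space of alternating $p$-linear forms on $\mathbb{R}^n$ with its scalar product $\langle\cdot\,;\cdot\rangle$, and let $\Omega\subset\mathbb{R}^n$ be open, bounded and non-empty. Let $W^{d,\infty}(\Omega;\Lambda^{p})$ be the space of all $\omega\in L^\infty(\Omega;\Lambda^{p})$ whose distributional exterior derivative $d\omega$ lies in $L^\infty(\Omega;\Lambda^{p+1})$; in it, $\omega^\nu\stackrel{*}{\rightharpoonup}\omega$ means that $\omega^\nu\stackrel{*}{\rightharpoonup}\omega$ and $d\omega^\nu\stackrel{*}{\rightharpoonup}d\omega$ weakly-$*$ in $L^\infty$. Let $f:\Lambda^{k_1}\times\dots\times\Lambda^{k_m}\to\mathbb{R}$ be weakly continuous on $\prod_{i=1}^m W^{d,\infty}(\Omega;\Lambda^{k_i-1})$, that is, $f$ is continuous and for all sequences with $\omega_i^\nu\stackrel{*}{\rightharpoonup}\omega_i$ in $W^{d,\infty}(\Omega;\Lambda^{k_i-1})$ for every $i$, $$f(d\omega_1^\nu,\dots,d\omega_m^\nu)\rightharpoonup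 f(d\omega_1,\dots,d\omega_m)\quad\text{in }\mathcal{D}'(\Omega).$$ Then $f$ is vectorially ext. one affine: for all $\xi_i\in\Lambda^{k_i}$, $a\in\Lambda^1$ and $\beta_i\in\Lambda^{k_i-1}$ the function $t\mapsto f(\xi_1+t\,a\wedge\beta_1,\dots,\xi_m+t\,a\wedge\beta_m)$ is affine on $\mathbb{R}$. Moreover, there are $c_\alpha\in\Lambda^{|k\alpha|}$, one for each multi-index $\alpha=(\alpha_1,\dots,\alpha_m)$ of integers with $0\le\alpha_i\le\lfloor n/k_i\rfloor$ and $|k\alpha|:=\sum_i k_i\alpha_i\le n$, such that $$f(\xi)=\sum_{\alpha,\ 0\le|k\alpha|\le n}\langle c_\alpha;\xi^\alpha\rangle\qquad\text{for all }\xi=(\xi_1,\dots,\xi_m)\in\Lambda^{k_1}\times\dots\times\Lambda^{k_m},$$ where $\xi^\alpha=\xi_1^{\alpha_1}\wedge\dots\wedge\xi_m^{\alpha_m}$ with $\xi_i^{\alpha_i}=\xi_i\wedge\dots\wedge\xi_i$ ($\alpha_i$ factors), and $\xi^0=1\in\Lambda^0=\mathbb{R}$. -/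

import Mathlib

open MeasureTheory Filter Topology TopologicalSpace
open scoped ENNReal

noncomputable section

/-- Euclidean space `ℝⁿ`. -/
abbrev Eucl (n : ℕ) : Type := EuclideanSpace ℝ (Fin n)

/-- `Λᵖ(ℝⁿ)`, the space of alternating `p`-linear forms on `ℝⁿ`
(all of them are continuous, since the dimension is finite). -/
abbrev Form (n p : ℕ) : Type := Eucl n [⋀^Fin p]→L[ℝ] ℝ

/-- A `p`-form regarded as a `q`-form when `p = q`. -/
def Form.castDeg {n p q : ℕ} (h : p = q) (ξ : Form n p) : Form n q := h ▸ ξ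

theorem Form.castDeg_apply {n p q : ℕ} (h : p = q) (ξ : Form n p) (v : Fin q → Eucl n) :
    ξ.castDeg h v = ξ (fun i => v (Fin.cast h i)) := by
  subst h; rfl

/-- The exterior product of alternating forms (sum over shuffles), as an alternating map. -/
def Form.wedgeAux {n p q : ℕ} (a : Form n p) (b : Form n q) :
    Eucl n [⋀^Fin (p + q)]→ₗ[ℝ] ℝ :=
  ((LinearMap.mul' ℝ ℝ).compAlternatingMap
    (a.toAlternatingMap.domCoprod b.toAlternatingMap)).domDomCongr finSumFinEquiv

theorem Form.wedgeAux_continuous {n p q : ℕ} (a : Form n p) (b : Form n q) :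
    Continuous (Form.wedgeAux a b) := by
  have key : ∀ σ : Equiv.Perm.ModSumCongr (Fin p) (Fin q),
      Continuous (fun v : Fin (p + q) → Eucl n => LinearMap.mul' ℝ ℝ
        (AlternatingMap.domCoprod.summand a.toAlternatingMap b.toAlternatingMap σ
          (fun i => v (finSumFinEquiv i)))) := by
    intro σ
    induction σ using Quotient.inductionOn' with
    | h σ =>
      have h1 : Continuous (fun v : Fin (p + q) → Eucl n =>
          a (fun i => v (finSumFinEquiv (σ (Sum.inl i))))) :=
        a.cont.comp (by fun_prop)
      have h2 : Continuous (fun v : Fin (p + q) → Eucl n =>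
          b (fun i => v (finSumFinEquiv (σ (Sum.inr i))))) :=
        b.cont.comp (by fun_prop)
      have h3 := (h1.mul h2).const_smul (Equiv.Perm.sign σ)
      refine h3.congr fun v => ?_
      rw [AlternatingMap.domCoprod.summand_mk'']
      rcases Int.units_eq_one_or (Equiv.Perm.sign σ) with h | h <;> rw [h] <;> simp
  have hsum : Continuous (fun v : Fin (p + q) → Eucl n =>
      ∑ σ : Equiv.Perm.ModSumCongr (Fin p) (Fin q), LinearMap.mul' ℝ ℝ
        (AlternatingMap.domCoprod.summand a.toAlternatingMap b.toAlternatingMap σ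
          (fun i => v (finSumFinEquiv i)))) :=
    continuous_finsetSum _ fun σ _ => key σ
  refine hsum.congr fun v => ?_
  simp [Form.wedgeAux, AlternatingMap.domCoprod_apply,
    Function.comp_def]

/-- The exterior product `a ∧ b ∈ Λ^{p+q}` of `a ∈ Λᵖ` and `b ∈ Λ^q`:
`(a ∧ b)(v) = ∑ sign(σ) a(v_{σ(1)}, …, v_{σ(p)}) b(v_{σ(p+1)}, …, v_{σ(p+q)})`,
summed over the `(p, q)`-shuffles `σ`. -/
def Form.wedge {n p q : ℕ} (a : Form n p) (b : Form n q) : Form n (p + q) :=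
  { Form.wedgeAux a b with cont := Form.wedgeAux_continuous a b }

/-- The constant `1 ∈ Λ⁰ = ℝ`. -/
def Form.one (n : ℕ) : Form n 0 := ContinuousAlternatingMap.constOfIsEmpty ℝ (Eucl n) (Fin 0) 1

/-- The wedge power `ξᵃ = ξ ∧ ⋯ ∧ ξ` (`a` factors; `ξ⁰ = 1`). -/
def Form.wedgePow {n p : ℕ} (ξ : Form n p) : (a : ℕ) → Form n (p * a)
  | 0 => Form.one n
  | a + 1 => (Form.wedgePow ξ a).wedge ξ

/-- The ordered exterior product `η₁ ∧ ⋯ ∧ η_m` of a tuple of forms. -/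
def Form.wedgeProd {n : ℕ} : {m : ℕ} → (d : Fin m → ℕ) → ((i : Fin m) → Form n (d i)) →
    Form n (∑ i, d i)
  | 0, d, _ => (Form.one n).castDeg (Fin.sum_univ_zero d).symm
  | _ + 1, d, η =>
      ((Form.wedgeProd (fun i => d i.castSucc) (fun i => η i.castSucc)).wedge
        (η (Fin.last _))).castDeg (Fin.sum_univ_castSucc d).symm

/-- `ξ^α = ξ₁^{α₁} ∧ ⋯ ∧ ξ_m^{α_m}` for a tuple of forms `ξ` and a multi-index `α`. -/
def Form.wedgeMultiPow {n m : ℕ} {k : Fin m → ℕ} (ξ : (i : Fin m) → Form n (k i))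
    (α : Fin m → ℕ) : Form n (∑ i, k i * α i) :=
  Form.wedgeProd (fun i => k i * α i) (fun i => (ξ i).wedgePow (α i))

/-- The scalar product of `Λᵖ(ℝⁿ)`:
`⟨a ; b⟩ = ∑ a(e_{j₁}, …, e_{j_p}) b(e_{j₁}, …, e_{j_p})` over `j₁ < ⋯ < j_p`. -/
def Form.pairing {n p : ℕ} (a b : Form n p) : ℝ :=
  ∑ J : Fin p ↪o Fin n,
    a (fun i => EuclideanSpace.single (J i) 1) * b (fun i => EuclideanSpace.single (J i) 1)

/-- The multi-indices `α` with `0 ≤ αᵢ ≤ [n / kᵢ]` and `|kα| = ∑ kᵢ αᵢ ≤ n`. -/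
def multiIndices (n : ℕ) {m : ℕ} (k : Fin m → ℕ) : Finset (Fin m → ℕ) :=
  (Fintype.piFinset fun i => Finset.range (n / k i + 1)).filter fun α => ∑ i, k i * α i ≤ n

/-- `f : ∏ Λ^{kᵢ} → ℝ`, where `kᵢ = lᵢ + 1`, is vectorially ext. one affine:
`t ↦ f(ξ₁ + t α ∧ β₁, …, ξ_m + t α ∧ β_m)` is affine for all `ξᵢ ∈ Λ^{kᵢ}`, `α ∈ Λ¹`,
`βᵢ ∈ Λ^{kᵢ-1}`. -/
def VectoriallyExtOneAffine {n m : ℕ} {l : Fin m → ℕ}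
    (f : ((i : Fin m) → Form n (l i + 1)) → ℝ) : Prop :=
  ∀ (ξ : (i : Fin m) → Form n (l i + 1)) (α : Form n 1) (β : (i : Fin m) → Form n (l i)),
    ∃ a b : ℝ, ∀ t : ℝ,
      f (fun i => ξ i + t • (α.wedge (β i)).castDeg (Nat.add_comm 1 (l i))) = a + b * t

/-- `η = dω` in `Ω` in the sense of distributions: for all constant vector fields
`v₀, …, v_p` and all `φ ∈ C_c^∞(Ω)`,
`∫ φ η(v₀, …, v_p) = - ∫ ∑ᵢ (-1)ⁱ (∂_{vᵢ} φ) ω(v₀, …, v̂ᵢ, …, v_p)`,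
where the sum is `(dφ ∧ ω)(v₀, …, v_p)`. -/
def IsWeakExtDeriv {n p : ℕ} (Ω : Opens (Eucl n)) (ω : Eucl n → Form n p)
    (η : Eucl n → Form n (p + 1)) : Prop :=
  ∀ (φ : TestFunction Ω ℝ ⊤) (v : Fin (p + 1) → Eucl n),
    ∫ x in (Ω : Set (Eucl n)), φ x * η x v =
      -∫ x in (Ω : Set (Eucl n)),
        ∑ i : Fin (p + 1), (-1 : ℝ) ^ (i : ℕ) * fderiv ℝ φ x (v i) * ω x (i.removeNth v)

/-- `ω ∈ W^{d,∞}(Ω; Λᵖ)` with weak exterior derivative `dω = η`: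
`ω ∈ L^∞(Ω; Λᵖ)`, `η ∈ L^∞(Ω; Λ^{p+1})` and `dω = η` in `Ω`. -/
structure MemWdInfty {n p : ℕ} (Ω : Opens (Eucl n)) (ω : Eucl n → Form n p)
    (η : Eucl n → Form n (p + 1)) : Prop where
  memLp : MemLp ω ∞ (volume.restrict (Ω : Set (Eucl n)))
  memLp_deriv : MemLp η ∞ (volume.restrict (Ω : Set (Eucl n)))
  isWeakExtDeriv : IsWeakExtDeriv Ω ω η

/-- Weak-* convergence in `L^∞(Ω; Λᵖ)`, the dual of `L¹(Ω; Λᵖ)`. -/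
def WeakStarTendsto {n p : ℕ} (Ω : Opens (Eucl n)) (u : ℕ → Eucl n → Form n p)
    (u₀ : Eucl n → Form n p) : Prop :=
  ∀ g : Eucl n → Form n p, IntegrableOn g (Ω : Set (Eucl n)) →
    Tendsto (fun ν => ∫ x in (Ω : Set (Eucl n)), Form.pairing (u ν x) (g x)) atTop
      (𝓝 (∫ x in (Ω : Set (Eucl n)), Form.pairing (u₀ x) (g x)))

/-- `f : ∏ Λ^{kᵢ} → ℝ`, where `kᵢ = lᵢ + 1`, is weakly continuous on
`W^{d,∞}(Ω; ∏ Λ^{kᵢ-1})`: it is continuous, and whenever `ω^ν` converges weakly-* to `ω` in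
`W^{d,∞}` (that is, `ω^νᵢ → ωᵢ` and `dω^νᵢ → dωᵢ` weakly-* in `L^∞` for every `i`), then
`f(dω^ν) → f(dω)` in `𝒟'(Ω)`. -/
def WeaklyContinuousOnWdInfty {n m : ℕ} {l : Fin m → ℕ} (Ω : Opens (Eucl n))
    (f : ((i : Fin m) → Form n (l i + 1)) → ℝ) : Prop :=
  Continuous f ∧
  ∀ (ω : ℕ → (i : Fin m) → Eucl n → Form n (l i))
    (dω : ℕ → (i : Fin m) → Eucl n → Form n (l i + 1))
    (ω₀ : (i : Fin m) → Eucl n → Form n (l i))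
    (dω₀ : (i : Fin m) → Eucl n → Form n (l i + 1)),
    (∀ ν i, MemWdInfty Ω (ω ν i) (dω ν i)) →
    (∀ i, MemWdInfty Ω (ω₀ i) (dω₀ i)) →
    (∀ i, WeakStarTendsto Ω (fun ν => ω ν i) (ω₀ i)) →
    (∀ i, WeakStarTendsto Ω (fun ν => dω ν i) (dω₀ i)) →
    ∀ φ : TestFunction Ω ℝ ⊤,
      Tendsto (fun ν => ∫ x in (Ω : Set (Eucl n)), φ x * f (fun i => dω ν i x)) atTop
        (𝓝 (∫ x in (Ω : Set (Eucl n)), φ x * f (fun i => dω₀ i x)))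

end

/-! Analytic half. On the bounded set Ω a constant form ξ of positive degree has a bounded
potential. For a covector a ≠ 0, add to it T((k+1) a·x)/(k+1) β, where T is the distance to the
nearest integer. This perturbation tends uniformly to 0, while its exterior derivative is a ∧ β
times a square wave of values ±1, which tends weakly-* to 0. Along this sequence f takes only the
values f(ξ + a ∧ β) and f(ξ - a ∧ β), so its weak limit is their mean, and weak continuity equates
that mean with f(ξ) (`WeaklyContinuousOnWdInfty.midpoint_eq`). Midpoint affinity and continuity give
affinity along a ∧ β.

Algebraic half. Monomials of positive degree have the form a ∧ β and span the forms, so f is affine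
in each coordinate and therefore smooth. Affinity for one a and all β makes the derivative of f
along a ∧ x invariant under translation by a ∧ y. Differentiating once more gives a bilinear map
that vanishes on all pairs (a ∧ x, a ∧ y); such a map depends only on the exterior product of its
arguments (`exists_factor_wedge`). The induced linear map lives in higher degree and inherits the
invariance, so the argument repeats until the degree exceeds n (`exists_wordProd_of_invariant`).
Integrating back along rays from 0 writes f through linear functionals of products of the ξᵢ; graded
commutativity sorts these into the ξ^α, and the scalar product represents the functionals. -/

noncomputable section

/-! ### Decomposable forms, the exterior algebra and the scalar product -/

namespace Form

variable {n p q : ℕ}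

/-- The `p`-form `v ↦ det (uᵢ (vⱼ))`, that is `u₁ ∧ ⋯ ∧ u_p`, for a tuple of covectors `u`. -/
def decomp (n p : ℕ) : Module.Dual ℝ (Eucl n) [⋀^Fin p]→ₗ[ℝ] Form n p :=
  -- The determinant is alternating in its rows, here the vectors; transposing shows that it is also
  -- alternating in the covectors.
  have key : ∀ (u : Fin p → Module.Dual ℝ (Eucl n)) (v : Fin p → Eucl n),
      Matrix.detRowAlternating (fun i j => u j (v i)) =
        (Matrix.detRowAlternating (R := ℝ)).compLinearMap
          (LinearMap.pi fun j => Module.Dual.eval ℝ (Eucl n) (v j)) u := fun u v =>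
    Matrix.det_transpose (Matrix.of fun i j => u i (v j))
  { toFun := fun u =>
      { (Matrix.detRowAlternating (n := Fin p) (R := ℝ)).compLinearMap (LinearMap.pi u) with
        cont := by
          have hu : ∀ j, Continuous (u j) := fun j => (u j).continuous_of_finiteDimensional
          change Continuous fun v : Fin p → Eucl n =>
            Matrix.det (Matrix.of fun i j => u j (v i))
          refine Continuous.matrix_det (continuous_matrix fun i j => ?_)
          exact (hu j).comp (continuous_apply i) }
    map_update_add' := fun u i x y => by
      ext v
      exact (key _ v).trans <| (AlternatingMap.map_update_add _ u i x y).trans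
        (congrArg₂ (· + ·) (key _ v).symm (key _ v).symm)
    map_update_smul' := fun u i c x => by
      ext v
      exact (key _ v).trans <| (AlternatingMap.map_update_smul _ u i c x).trans
        (congrArg (c • ·) (key _ v).symm)
    map_eq_zero_of_eq' := fun u i j h hij => by
      ext v
      exact (key _ v).trans (AlternatingMap.map_eq_zero_of_eq _ u h hij) }

theorem decomp_apply (u : Fin p → Module.Dual ℝ (Eucl n)) (v : Fin p → Eucl n) :
    decomp n p u v = Matrix.det (Matrix.of fun i j => u i (v j)) :=
  (Matrix.det_transpose _).symm

theorem decomp_apply_sum (u : Fin p → Module.Dual ℝ (Eucl n)) (v : Fin p → Eucl n) :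
    decomp n p u v = ∑ σ : Equiv.Perm (Fin p), (Equiv.Perm.sign σ : ℤ) • ∏ i, u i (v (σ i)) :=
  Matrix.det_apply _

theorem decomp_toAlternatingMap (u : Fin p → Module.Dual ℝ (Eucl n)) :
    (decomp n p u).toAlternatingMap =
      MultilinearMap.alternatization
        ((MultilinearMap.mkPiAlgebra ℝ (Fin p) ℝ).compLinearMap u) := by
  ext v
  rw [MultilinearMap.alternatization_apply]
  refine (decomp_apply_sum u v).trans ?_
  refine Finset.sum_congr rfl fun σ _ => ?_
  simp [Units.smul_def]

theorem wedge_apply (a : Form n p) (b : Form n q) (v : Fin (p + q) → Eucl n) :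
    a.wedge b v = LinearMap.mul' ℝ ℝ
      (a.toAlternatingMap.domCoprod b.toAlternatingMap (fun i => v (finSumFinEquiv i))) := rfl

/-- Both factors are alternatizations of products of covectors, and the shuffle product of two
alternatizations is the alternatization of the joint product. -/
theorem decomp_wedge_decomp (u : Fin p → Module.Dual ℝ (Eucl n))
    (w : Fin q → Module.Dual ℝ (Eucl n)) :
    (decomp n p u).wedge (decomp n q w) = decomp n (p + q) (Fin.append u w) := by
  ext v
  rw [wedge_apply, decomp_toAlternatingMap, decomp_toAlternatingMap,
    ← MultilinearMap.domCoprod_alternization, MultilinearMap.alternatization_apply,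
    decomp_apply_sum, map_sum]
  refine Fintype.sum_equiv finSumFinEquiv.permCongr _ _ fun σ => ?_
  rw [Equiv.Perm.sign_permCongr, Fin.prod_univ_add]
  rcases Int.units_eq_one_or (Equiv.Perm.sign σ) with h | h <;> simp [h]

theorem wedge_add_left (a a' : Form n p) (b : Form n q) :
    (a + a').wedge b = a.wedge b + a'.wedge b := by
  ext v
  simp only [wedge_apply, ContinuousAlternatingMap.add_apply]
  rw [← map_add, ← AlternatingMap.add_apply]
  simp only [← AlternatingMap.domCoprod'_apply]
  rw [← map_add, ← TensorProduct.add_tmul]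
  rfl

theorem wedge_add_right (a : Form n p) (b b' : Form n q) :
    a.wedge (b + b') = a.wedge b + a.wedge b' := by
  ext v
  simp only [wedge_apply, ContinuousAlternatingMap.add_apply]
  rw [← map_add, ← AlternatingMap.add_apply]
  simp only [← AlternatingMap.domCoprod'_apply]
  rw [← map_add, ← TensorProduct.tmul_add]
  rfl

theorem wedge_smul_left (c : ℝ) (a : Form n p) (b : Form n q) :
    (c • a).wedge b = c • a.wedge b := by
  ext v
  simp only [wedge_apply, ContinuousAlternatingMap.smul_apply]
  rw [← map_smul, ← AlternatingMap.smul_apply]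
  simp only [← AlternatingMap.domCoprod'_apply]
  rw [← map_smul, TensorProduct.smul_tmul']
  rfl

theorem wedge_smul_right (c : ℝ) (a : Form n p) (b : Form n q) :
    a.wedge (c • b) = c • a.wedge b := by
  ext v
  simp only [wedge_apply, ContinuousAlternatingMap.smul_apply]
  rw [← map_smul, ← AlternatingMap.smul_apply]
  simp only [← AlternatingMap.domCoprod'_apply]
  rw [← map_smul, ← TensorProduct.tmul_smul]
  rfl

/-- The exterior product as a bilinear map. -/
def wedgeL (n p q : ℕ) : Form n p →ₗ[ℝ] Form n q →ₗ[ℝ] Form n (p + q) :=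
  LinearMap.mk₂ ℝ wedge wedge_add_left wedge_smul_left wedge_add_right wedge_smul_right

@[simp] theorem wedgeL_apply (a : Form n p) (b : Form n q) : wedgeL n p q a b = a.wedge b := rfl

/-- The coordinate covectors. -/
def dcoord (n : ℕ) (i : Fin n) : Module.Dual ℝ (Eucl n) :=
  (EuclideanSpace.proj i : Eucl n →L[ℝ] ℝ).toLinearMap

@[simp] theorem dcoord_apply (i : Fin n) (x : Eucl n) : dcoord n i x = x i := rfl

theorem eucl_eq_sum (x : Eucl n) : x = ∑ i, x i • EuclideanSpace.single i (1 : ℝ) := by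
  ext j
  simp [Finset.sum_apply, Pi.single_apply]

theorem dual_eq_sum (u : Module.Dual ℝ (Eucl n)) :
    u = ∑ i, u (EuclideanSpace.single i (1 : ℝ)) • dcoord n i := by
  ext x
  conv_lhs => rw [eucl_eq_sum x]
  simp [mul_comm]

theorem apply_eq_sum (ζ : Form n p) (v : Fin p → Eucl n) :
    ζ v = ∑ I : Fin p → Fin n, (∏ i, v i (I i)) *
      ζ (fun i => EuclideanSpace.single (I i) (1 : ℝ)) := by
  conv_lhs => rw [funext fun i => eucl_eq_sum (v i)]
  have h := ζ.toMultilinearMap.map_sum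
    (fun i (j : Fin n) => v i j • EuclideanSpace.single j (1 : ℝ))
  refine h.trans (Finset.sum_congr rfl fun I _ => ?_)
  exact ζ.toMultilinearMap.map_smul_univ _ _

theorem alternating_dual_apply_eq_sum {W : Type*} [AddCommGroup W] [Module ℝ W]
    (M : Module.Dual ℝ (Eucl n) [⋀^Fin p]→ₗ[ℝ] W) (u : Fin p → Module.Dual ℝ (Eucl n)) :
    M u = ∑ I : Fin p → Fin n, (∏ i, u i (EuclideanSpace.single (I i) (1 : ℝ))) •
      M (fun i => dcoord n (I i)) := by
  conv_lhs => rw [funext fun i => dual_eq_sum (u i)]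
  have h := M.toMultilinearMap.map_sum
    (fun i (j : Fin n) => u i (EuclideanSpace.single j (1 : ℝ)) • dcoord n j)
  refine h.trans (Finset.sum_congr rfl fun I _ => ?_)
  exact M.toMultilinearMap.map_smul_univ _ _

/-- The linear map on `p`-forms induced by an alternating map on covectors. -/
def liftDecomp {W : Type*} [AddCommGroup W] [Module ℝ W]
    (M : Module.Dual ℝ (Eucl n) [⋀^Fin p]→ₗ[ℝ] W) : Form n p →ₗ[ℝ] W where
  toFun ζ := (p.factorial : ℝ)⁻¹ • ∑ I : Fin p → Fin n,
    ζ (fun i => EuclideanSpace.single (I i) (1 : ℝ)) • M (fun i => dcoord n (I i))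
  map_add' ζ η := by simp [add_smul, Finset.sum_add_distrib]
  map_smul' c ζ := by
    simp only [ContinuousAlternatingMap.smul_apply, smul_eq_mul, mul_smul, ← Finset.smul_sum,
      RingHom.id_apply]
    rw [smul_comm]

theorem liftDecomp_apply {W : Type*} [AddCommGroup W] [Module ℝ W]
    (M : Module.Dual ℝ (Eucl n) [⋀^Fin p]→ₗ[ℝ] W) (ζ : Form n p) :
    liftDecomp M ζ = (p.factorial : ℝ)⁻¹ • ∑ I : Fin p → Fin n,
      ζ (fun i => EuclideanSpace.single (I i) (1 : ℝ)) • M (fun i => dcoord n (I i)) := rfl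

theorem inv_factorial_smul_sum_perm {W : Type*} [AddCommGroup W] [Module ℝ W] (x : W) :
    (p.factorial : ℝ)⁻¹ • ∑ _σ : Equiv.Perm (Fin p), x = x := by
  rw [Finset.sum_const, Finset.card_univ, Fintype.card_perm, Fintype.card_fin,
    ← Nat.cast_smul_eq_nsmul ℝ, smul_smul, inv_mul_cancel₀ (by positivity), one_smul]

/-- Universal property of Λᵖ as an exterior power. The sum runs over all index tuples, so each of
the p! permutations in the determinant contributes `M u`, which the factor 1/p! compensates. -/
theorem liftDecomp_decomp {W : Type*} [AddCommGroup W] [Module ℝ W]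
    (M : Module.Dual ℝ (Eucl n) [⋀^Fin p]→ₗ[ℝ] W) (u : Fin p → Module.Dual ℝ (Eucl n)) :
    liftDecomp M (decomp n p u) = M u := by
  rw [liftDecomp_apply, ← inv_factorial_smul_sum_perm (p := p) (M u)]
  congr 1
  simp only [decomp_apply_sum, Finset.sum_smul]
  rw [Finset.sum_comm]
  refine Finset.sum_congr rfl fun σ _ => ?_
  rw [alternating_dual_apply_eq_sum M u]
  refine Fintype.sum_equiv (σ.arrowCongr (Equiv.refl (Fin n))).symm _ _ fun I => ?_
  have h1 : (fun i => dcoord n ((σ.arrowCongr (Equiv.refl (Fin n))).symm I i)) =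
      (fun i => dcoord n (I i)) ∘ σ := by ext; simp
  rw [h1, AlternatingMap.map_perm]
  rcases Int.units_eq_one_or (Equiv.Perm.sign σ) with h | h <;> simp [h]

theorem liftDecomp_decomp_self (ζ : Form n p) : liftDecomp (decomp n p) ζ = ζ := by
  rw [liftDecomp_apply]
  ext v
  conv_rhs => rw [← inv_factorial_smul_sum_perm (p := p) (ζ v)]
  rw [ContinuousAlternatingMap.smul_apply, ContinuousAlternatingMap.sum_apply]
  congr 1
  simp only [ContinuousAlternatingMap.smul_apply, decomp_apply_sum, Finset.smul_sum]
  rw [Finset.sum_comm]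
  refine Finset.sum_congr rfl fun σ _ => ?_
  have h1 : ζ v = (Equiv.Perm.sign σ : ℤ) • ζ (v ∘ σ) := by
    have := ζ.toAlternatingMap.map_perm v σ
    have h2 : ζ (v ∘ σ) = Equiv.Perm.sign σ • ζ v := this
    rw [h2]
    rcases Int.units_eq_one_or (Equiv.Perm.sign σ) with h | h <;> simp [h]
  rw [h1, apply_eq_sum, Finset.smul_sum]
  refine Finset.sum_congr rfl fun I _ => ?_
  simp only [dcoord_apply, Function.comp]
  rw [smul_comm, smul_eq_mul, mul_comm]

theorem span_range_decomp : Submodule.span ℝ (Set.range (decomp n p)) = ⊤ := by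
  refine Submodule.eq_top_iff'.2 fun ζ => ?_
  rw [← liftDecomp_decomp_self ζ, liftDecomp_apply]
  exact Submodule.smul_mem _ _ (Submodule.sum_mem _ fun I _ =>
    Submodule.smul_mem _ _ (Submodule.subset_span ⟨_, rfl⟩))

@[elab_as_elim]
theorem decomp_induction {P : Form n p → Prop} (ζ : Form n p)
    (h : ∀ u, P (decomp n p u)) (h0 : P 0)
    (hadd : ∀ x y, P x → P y → P (x + y)) (hsmul : ∀ (c : ℝ) x, P x → P (c • x)) : P ζ := by
  have : ζ ∈ Submodule.span ℝ (Set.range (decomp n p)) := by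
    rw [span_range_decomp]; trivial
  refine Submodule.span_induction (p := fun x _ => P x) ?_ h0
    (fun x y _ _ => hadd x y) (fun c x _ => hsmul c x) this
  rintro _ ⟨u, rfl⟩
  exact h u

instance : FiniteDimensional ℝ (Form n p) := by
  classical
  refine ⟨⟨Finset.univ.image fun I : Fin p → Fin n => decomp n p fun i => dcoord n (I i), ?_⟩⟩
  refine Submodule.eq_top_iff'.2 fun ζ => ?_
  rw [← liftDecomp_decomp_self ζ, liftDecomp_apply]
  exact Submodule.smul_mem _ _ (Submodule.sum_mem _ fun I _ =>
    Submodule.smul_mem _ _ (Submodule.subset_span (by simp)))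

theorem linearMap_ext {W : Type*} [AddCommGroup W] [Module ℝ W] {f g : Form n p →ₗ[ℝ] W}
    (h : ∀ u, f (decomp n p u) = g (decomp n p u)) : f = g := by
  ext ζ
  induction ζ using decomp_induction with
  | h u => exact h u
  | h0 => simp
  | hadd x y hx hy => simp [hx, hy]
  | hsmul c x hx => simp [hx]

/-- The embedding of `p`-forms into the exterior algebra of the dual space. -/
def toExt (n p : ℕ) : Form n p →ₗ[ℝ] ExteriorAlgebra ℝ (Module.Dual ℝ (Eucl n)) :=
  liftDecomp (ExteriorAlgebra.ιMulti ℝ p)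

theorem toExt_decomp (u : Fin p → Module.Dual ℝ (Eucl n)) :
    toExt n p (decomp n p u) = ExteriorAlgebra.ιMulti ℝ p u := liftDecomp_decomp _ _

/-- The projection of the exterior algebra onto `p`-forms. -/
def ofExt (n p : ℕ) : ExteriorAlgebra ℝ (Module.Dual ℝ (Eucl n)) →ₗ[ℝ] Form n p :=
  ExteriorAlgebra.liftAlternating fun i =>
    if h : i = p then h ▸ decomp n i else 0

theorem ofExt_toExt (ζ : Form n p) : ofExt n p (toExt n p ζ) = ζ := by
  have : (ofExt n p).comp (toExt n p) = LinearMap.id := linearMap_ext fun u => by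
    rw [LinearMap.comp_apply, toExt_decomp, ofExt, ExteriorAlgebra.liftAlternating_apply_ιMulti]
    simp
  exact LinearMap.congr_fun this ζ

/-- Transfers associativity and graded commutativity from the exterior algebra, where no degree
casts intervene. -/
theorem toExt_wedge (a : Form n p) (b : Form n q) :
    toExt n (p + q) (a.wedge b) = toExt n p a * toExt n q b := by
  have : (wedgeL n p q).compr₂ (toExt n (p + q)) =
      (LinearMap.mul ℝ (ExteriorAlgebra ℝ (Module.Dual ℝ (Eucl n)))).compl₁₂
        (toExt n p) (toExt n q) :=
    linearMap_ext fun u => linearMap_ext fun w => by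
      simp [decomp_wedge_decomp, toExt_decomp, ExteriorAlgebra.ιMulti_mul_ιMulti]
  exact LinearMap.congr_fun₂ this a b

theorem toExt_castDeg (h : p = q) (a : Form n p) : toExt n q (a.castDeg h) = toExt n p a := by
  subst h; rfl

theorem toExt_injective : Function.Injective (toExt n p) :=
  Function.LeftInverse.injective ofExt_toExt

theorem toExt_one : toExt n 0 (one n) = 1 := by
  have : one n = decomp n 0 Fin.elim0 := by
    ext v; simp [one, decomp_apply]
  rw [this, toExt_decomp, ExteriorAlgebra.ιMulti_zero_apply]

theorem toExt_wedgePow (ξ : Form n p) (a : ℕ) :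
    toExt n (p * a) (ξ.wedgePow a) = toExt n p ξ ^ a := by
  induction a with
  | zero => rw [pow_zero]; exact toExt_one
  | succ a ih =>
    rw [pow_succ, ← ih]
    exact toExt_wedge _ _

theorem toExt_wedgeProd {m : ℕ} (d : Fin m → ℕ) (η : (i : Fin m) → Form n (d i)) :
    toExt n (∑ i, d i) (wedgeProd d η) = (List.ofFn fun i => toExt n (d i) (η i)).prod := by
  induction m with
  | zero => rw [wedgeProd, toExt_castDeg, toExt_one]; simp
  | succ m ih =>
    rw [wedgeProd, toExt_castDeg, toExt_wedge, ih, List.ofFn_succ', List.concat_eq_append,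
      List.prod_append, List.prod_singleton]

theorem toExt_wedgeMultiPow {m : ℕ} {k : Fin m → ℕ} (ξ : (i : Fin m) → Form n (k i))
    (α : Fin m → ℕ) :
    toExt n (∑ i, k i * α i) (wedgeMultiPow ξ α) =
      (List.ofFn fun i => toExt n (k i) (ξ i) ^ α i).prod := by
  rw [wedgeMultiPow, toExt_wedgeProd]
  simp only [toExt_wedgePow]

/-- More than n covectors are linearly dependent, so every decomposable form vanishes. -/
theorem eq_zero_of_lt (h : n < p) (ζ : Form n p) : ζ = 0 := by
  induction ζ using decomp_induction with
  | h u =>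
    refine AlternatingMap.map_linearDependent _ _ fun hu => ?_
    have := hu.fintype_card_le_finrank
    simp [Subspace.dual_finrank_eq] at this
    omega
  | h0 => rfl
  | hadd x y hx hy => simp [hx, hy]
  | hsmul c x hx => simp [hx]

/-- The scalar product as a bilinear map. -/
def pairingL (n p : ℕ) : Form n p →ₗ[ℝ] Form n p →ₗ[ℝ] ℝ :=
  LinearMap.mk₂ ℝ pairing
    (fun a b c => by simp [pairing, add_mul, Finset.sum_add_distrib])
    (fun r a b => by simp [pairing, mul_assoc, Finset.mul_sum])
    (fun a b c => by simp [pairing, mul_add, Finset.sum_add_distrib])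
    (fun r a b => by simp [pairing, mul_left_comm, Finset.mul_sum])

@[simp] theorem pairingL_apply (a b : Form n p) : pairingL n p a b = pairing a b := rfl

theorem eq_zero_of_apply_single_eq_zero (a : Form n p)
    (h : ∀ J : Fin p ↪o Fin n, a (fun i => EuclideanSpace.single (J i) 1) = 0) : a = 0 := by
  ext v
  rw [apply_eq_sum]
  refine Finset.sum_eq_zero fun I _ => ?_
  rw [mul_eq_zero]; right
  by_cases hI : Function.Injective I
  · have hmono : StrictMono (I ∘ Tuple.sort I) :=
      (Tuple.monotone_sort I).strictMono_of_injective (hI.comp (Equiv.injective _))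
    have h1 := h (OrderEmbedding.ofStrictMono _ hmono)
    have h2 := a.toAlternatingMap.map_perm
      (fun i => EuclideanSpace.single (I i) (1 : ℝ)) (Tuple.sort I)
    have h3 : a ((fun i => EuclideanSpace.single (I i) (1 : ℝ)) ∘ Tuple.sort I) = 0 := h1
    have h4 : a ((fun i => EuclideanSpace.single (I i) (1 : ℝ)) ∘ Tuple.sort I) = _ := h2
    rw [h3] at h4
    rcases Int.units_eq_one_or (Equiv.Perm.sign (Tuple.sort I)) with h5 | h5
    · simpa [h5] using h4.symm
    · simpa [h5] using h4.symm
  · obtain ⟨i, j, hij, hne⟩ := Function.not_injective_iff.1 hI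
    exact a.map_eq_zero_of_eq _ (by rw [hij]) hne

/-- Riesz representation: definiteness of the scalar product gives injectivity, and equality of
dimensions gives surjectivity. -/
theorem exists_pairing_eq (L : Form n p →ₗ[ℝ] ℝ) : ∃ c : Form n p, ∀ ζ, L ζ = pairing c ζ := by
  have hinj : Function.Injective (pairingL n p) := by
    rw [injective_iff_map_eq_zero]
    intro a ha
    have h0 : pairing a a = 0 := LinearMap.congr_fun ha a
    refine eq_zero_of_apply_single_eq_zero a fun J => ?_
    rw [pairing, Finset.sum_eq_zero_iff_of_nonneg fun _ _ => mul_self_nonneg _] at h0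
    exact mul_self_eq_zero.1 (h0 J (Finset.mem_univ _))
  have hsurj : Function.Surjective (pairingL n p) :=
    (LinearMap.injective_iff_surjective_of_finrank_eq_finrank
      (Subspace.dual_finrank_eq (K := ℝ) (V := Form n p)).symm).1 hinj
  obtain ⟨c, hc⟩ := hsurj L
  exact ⟨c, fun ζ => by rw [← hc]; rfl⟩

end Form

/-! ### Factoring bilinear maps through the exterior product -/

namespace Form

variable {n p q : ℕ}

/-- `a ∧ β` for `a ∈ Λ¹` and `β ∈ Λᵖ`, linear in `β`. -/
def wedgeOne (a : Form n 1) : Form n p →ₗ[ℝ] Form n (p + 1) where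
  toFun β := (a.wedge β).castDeg (Nat.add_comm 1 p)
  map_add' x y := by
    ext v; simp [castDeg_apply, wedge_add_right]
  map_smul' c x := by
    ext v; simp [castDeg_apply, wedge_smul_right]

theorem wedgeOne_apply (a : Form n 1) (β : Form n p) :
    wedgeOne a β = (a.wedge β).castDeg (Nat.add_comm 1 p) := rfl

theorem toExt_wedgeOne (a : Form n 1) (β : Form n p) :
    toExt n (p + 1) (wedgeOne a β) = toExt n 1 a * toExt n p β := by
  rw [wedgeOne_apply, toExt_castDeg, toExt_wedge]

theorem wedgeOne_decomp (u : Module.Dual ℝ (Eucl n)) (w : Fin p → Module.Dual ℝ (Eucl n)) :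
    wedgeOne (decomp n 1 fun _ => u) (decomp n p w) = decomp n (p + 1) (Fin.cons u w) := by
  apply toExt_injective
  rw [toExt_wedgeOne, toExt_decomp, toExt_decomp, toExt_decomp, ExteriorAlgebra.ιMulti_succ_apply,
    ExteriorAlgebra.ιMulti_succ_apply]
  simp [Matrix.vecTail, Function.comp_def]

/-- A transposition brings the i-th covector to the front; its sign is absorbed into `x`. -/
theorem exists_decomp_eq_wedgeOne (u : Fin (p + 1) → Module.Dual ℝ (Eucl n)) (i : Fin (p + 1)) :
    ∃ x : Form n p, decomp n (p + 1) u = wedgeOne (decomp n 1 fun _ => u i) x := by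
  have key : decomp n (p + 1) (u ∘ Equiv.swap 0 i) =
      wedgeOne (decomp n 1 fun _ => u i) (decomp n p (Fin.tail (u ∘ Equiv.swap 0 i))) := by
    rw [wedgeOne_decomp]
    congr 1
    conv_lhs => rw [← Fin.cons_self_tail (u ∘ Equiv.swap 0 i)]
    simp
  rw [AlternatingMap.map_perm] at key
  rcases Int.units_eq_one_or (Equiv.Perm.sign (Equiv.swap 0 i)) with h | h
  · rw [h, one_smul] at key
    exact ⟨_, key⟩
  · refine ⟨-decomp n p (Fin.tail (u ∘ Equiv.swap 0 i)), ?_⟩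
    rw [map_neg, ← key, h]
    simp

theorem decomp_eq_wedge (u : Fin (p + q) → Module.Dual ℝ (Eucl n)) :
    decomp n (p + q) u = (decomp n p fun i => u (Fin.castAdd q i)).wedge
      (decomp n q fun i => u (Fin.natAdd p i)) := by
  rw [decomp_wedge_decomp, Fin.append_castAdd_natAdd]

/-- Associativity, with a splitting of the covectors that does not depend on `a`. -/
theorem exists_toExt_wedgeOne_decomp {N : ℕ} (h : N = p + q)
    (u : Fin N → Module.Dual ℝ (Eucl n)) : ∃ (x : Form n p) (y : Form n q), ∀ a : Form n 1,
      toExt n (N + 1) (wedgeOne a (decomp n N u)) =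
        toExt n (p + 1) (wedgeOne a x) * toExt n q y := by
  subst h
  refine ⟨decomp n p fun i => u (Fin.castAdd q i), decomp n q fun i => u (Fin.natAdd p i),
    fun a => ?_⟩
  rw [decomp_eq_wedge, toExt_wedgeOne, toExt_wedge, toExt_wedgeOne, mul_assoc]

theorem exists_wedgeOne_decomp_eq_wedge (u : Fin (p + 1 + q) → Module.Dual ℝ (Eucl n)) :
    ∃ (x : Form n p) (y : Form n (q + 1)), ∀ a : Form n 1,
      wedgeOne a (decomp n (p + 1 + q) u) = (wedgeOne a x).wedge y := by
  have h : p + 1 + q = p + (q + 1) := by omega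
  obtain ⟨x, y, hxy⟩ := exists_toExt_wedgeOne_decomp h u
  refine ⟨x, y, fun a => toExt_injective ?_⟩
  rw [hxy]
  exact (toExt_wedge (q := q + 1) (wedgeOne a x) y).symm

/-- A bilinear map vanishing on all pairs `(a ∧ x, a ∧ y)` factors through the exterior product. -/
theorem exists_factor_wedge {W : Type*} [AddCommGroup W] [Module ℝ W]
    (B : Form n (p + 1) →ₗ[ℝ] Form n (q + 1) →ₗ[ℝ] W)
    (hB : ∀ (a : Form n 1) (x : Form n p) (y : Form n q), B (wedgeOne a x) (wedgeOne a y) = 0) :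
    ∃ L : Form n (p + 1 + (q + 1)) →ₗ[ℝ] W, ∀ x y, B x y = L (x.wedge y) := by
  let M₀ : MultilinearMap ℝ (fun _ : Fin (p + 1 + (q + 1)) => Module.Dual ℝ (Eucl n)) W :=
    ((TensorProduct.lift B).compMultilinearMap (MultilinearMap.domCoprod
      (decomp n (p + 1)).toMultilinearMap (decomp n (q + 1)).toMultilinearMap)).domDomCongr
        finSumFinEquiv
  have hM₀ : ∀ u, M₀ u = B (decomp n (p + 1) fun i => u (Fin.castAdd (q + 1) i))
      (decomp n (q + 1) fun i => u (Fin.natAdd (p + 1) i)) := fun u => rfl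
  -- A covector shared by the two blocks can be pulled to the front of both factors, which is the
  -- situation excluded by `hB`. Repetition inside one block is harmless because `decomp` is
  -- alternating.
  have hmix : ∀ (u : Fin (p + 1 + (q + 1)) → Module.Dual ℝ (Eucl n)) i j,
      u (Fin.castAdd (q + 1) i) = u (Fin.natAdd (p + 1) j) → M₀ u = 0 := by
    intro u i j h
    obtain ⟨x, hx⟩ := exists_decomp_eq_wedgeOne (fun i => u (Fin.castAdd (q + 1) i)) i
    obtain ⟨y, hy⟩ := exists_decomp_eq_wedgeOne (fun i => u (Fin.natAdd (p + 1) i)) j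
    rw [hM₀, hx, hy]
    simp only [h]
    exact hB _ _ _
  let M : Module.Dual ℝ (Eucl n) [⋀^Fin (p + 1 + (q + 1))]→ₗ[ℝ] W :=
    { M₀ with
      map_eq_zero_of_eq' := fun u i j h hij => by
        change M₀ u = 0
        induction i using Fin.addCases with
        | left i =>
          induction j using Fin.addCases with
          | left j =>
            rw [hM₀, AlternatingMap.map_eq_zero_of_eq (decomp n (p + 1)) _ h
              (fun hh => hij (by rw [hh]))]
            simp
          | right j => exact hmix u i j h
        | right i =>
          induction j using Fin.addCases with
          | left j => exact hmix u j i h.symm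
          | right j =>
            rw [hM₀, AlternatingMap.map_eq_zero_of_eq (decomp n (q + 1)) _ h
              (fun hh => hij (by rw [hh]))]
            simp }
  have hBL : B = (wedgeL n (p + 1) (q + 1)).compr₂ (liftDecomp M) :=
    linearMap_ext fun u => linearMap_ext fun w => by
      rw [LinearMap.compr₂_apply, wedgeL_apply, decomp_wedge_decomp, liftDecomp_decomp]
      change _ = M₀ _
      rw [hM₀]
      simp
  exact ⟨liftDecomp M, fun x y => LinearMap.congr_fun₂ hBL x y⟩

end Form

open Form

/-! ### Integrating derivatives to exterior words -/

section Structure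

variable {n m : ℕ} {l : Fin m → ℕ}

/-- The product `ξ_{w₁} ∧ ⋯ ∧ ξ_{w_r}` in the exterior algebra. -/
def wordProd (ξ : (i : Fin m) → Form n (l i + 1)) (w : List (Fin m)) :
    ExteriorAlgebra ℝ (Module.Dual ℝ (Eucl n)) :=
  (w.map fun i => toExt n (l i + 1) (ξ i)).prod

theorem wordProd_smul (t : ℝ) (ξ : (i : Fin m) → Form n (l i + 1)) (w : List (Fin m)) :
    wordProd (t • ξ) w = t ^ w.length • wordProd ξ w := by
  induction w with
  | nil => simp [wordProd]
  | cons i w ih =>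
    have h : ∀ η : (i : Fin m) → Form n (l i + 1),
      wordProd η (i :: w) = toExt n (l i + 1) (η i) * wordProd η w := fun η => by simp [wordProd]
    rw [h, h, ih, Pi.smul_apply, map_smul, smul_mul_smul_comm, List.length_cons, pow_succ']

/-- A function whose partial derivatives are combinations of exterior words is a combination of
exterior words. -/
theorem eq_add_sum_wordProd_of_fderiv {F : ((i : Fin m) → Form n (l i + 1)) → ℝ}
    (hF : Differentiable ℝ F) {ι : Fin m → Type} [∀ i, Fintype (ι i)]
    (w : (i : Fin m) → ι i → List (Fin m))
    (L : (i : Fin m) → ι i → ExteriorAlgebra ℝ (Module.Dual ℝ (Eucl n)) →ₗ[ℝ] ℝ)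
    (h : ∀ ξ i η, fderiv ℝ F ξ (Pi.single i η) =
      ∑ j, L i j (toExt n (l i + 1) η * wordProd ξ (w i j)))
    (ξ : (i : Fin m) → Form n (l i + 1)) :
    F ξ = F 0 + ∑ i, ∑ j, ((w i j).length + 1 : ℝ)⁻¹ * L i j (wordProd ξ (i :: w i j)) := by
  have h1 : ∀ t : ℝ, HasDerivAt (fun t : ℝ => F (t • ξ))
      (∑ i, ∑ j, t ^ (w i j).length * L i j (wordProd ξ (i :: w i j))) t := by
    intro t
    have h2 : HasDerivAt (fun t : ℝ => t • ξ) ξ t := by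
      simpa using (hasDerivAt_id t).smul_const ξ
    have h3 := (hF (t • ξ)).hasFDerivAt.comp_hasDerivAt t h2
    refine h3.congr_deriv ?_
    conv_lhs => rw [← Finset.univ_sum_single ξ, map_sum]
    refine Finset.sum_congr rfl fun i _ => ?_
    rw [Finset.univ_sum_single, h]
    refine Finset.sum_congr rfl fun j _ => ?_
    rw [wordProd_smul, mul_smul_comm, map_smul, smul_eq_mul]
    simp [wordProd]
  -- Explicit antiderivative in `t` of the derivative of `F` along the ray; the two sides are
  -- compared between 0 and 1.
  have h4 : ∀ t : ℝ, HasDerivAt (fun t : ℝ => ∑ i, ∑ j, ((w i j).length + 1 : ℝ)⁻¹ *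
      t ^ ((w i j).length + 1) * L i j (wordProd ξ (i :: w i j)))
      (∑ i, ∑ j, t ^ (w i j).length * L i j (wordProd ξ (i :: w i j))) t := by
    intro t
    refine HasDerivAt.fun_sum fun i _ => HasDerivAt.fun_sum fun j _ => ?_
    refine HasDerivAt.mul_const ?_ _
    refine ((hasDerivAt_pow ((w i j).length + 1) t).const_mul
      (((w i j).length + 1 : ℝ)⁻¹)).congr_deriv ?_
    have : ((w i j).length + 1 : ℝ) ≠ 0 := by positivity
    push_cast
    rw [← mul_assoc, inv_mul_cancel₀ this]
    simp
  have h5 := is_const_of_deriv_eq_zero (f := fun t : ℝ => F (t • ξ) -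
      ∑ i, ∑ j, ((w i j).length + 1 : ℝ)⁻¹ *
      t ^ ((w i j).length + 1) * L i j (wordProd ξ (i :: w i j)))
    (fun t => ((h1 t).sub (h4 t)).differentiableAt)
    (fun t => ((h1 t).sub (h4 t)).deriv.trans (sub_self _)) 1 0
  simp at h5
  linarith

/-- Directions `a ∧ β` in the product of the spaces of forms. -/
def wedgeDir (a : Form n 1) (β : (i : Fin m) → Form n (l i)) : (i : Fin m) → Form n (l i + 1) :=
  fun i => wedgeOne a (β i)

theorem single_wedgeOne (a : Form n 1) (i : Fin m) (x : Form n (l i)) :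
    (Pi.single i (wedgeOne a x) : (i : Fin m) → Form n (l i + 1)) =
      wedgeDir a (Pi.single i x) := by
  funext j
  by_cases h : j = i
  · subst h; simp [wedgeDir]
  · simp [wedgeDir, h]

theorem smul_wedgeDir (t : ℝ) (a : Form n 1) (β : (i : Fin m) → Form n (l i)) :
    t • wedgeDir a β = wedgeDir a (t • β) := by
  funext j; simp [wedgeDir]

theorem add_wedgeDir (a : Form n 1) (β γ : (i : Fin m) → Form n (l i)) :
    wedgeDir a β + wedgeDir a γ = wedgeDir a (β + γ) := by
  funext j; simp [wedgeDir]

/-- A directional derivative sees only the restriction to a line, up to an additive constant. -/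
theorem fderiv_eq_of_line {E : Type*} [NormedAddCommGroup E] [NormedSpace ℝ E] {F G : E → ℝ}
    {ξ ζ v : E} (hF : Differentiable ℝ F) (hG : Differentiable ℝ G) {c : ℝ}
    (h : ∀ t : ℝ, F (ξ + t • v) = G (ζ + t • v) + c) :
    fderiv ℝ F ξ v = fderiv ℝ G ζ v := by
  have h1 := (hF ξ).hasFDerivAt.hasLineDerivAt v
  have h2 : HasDerivAt (fun t : ℝ => G (ζ + t • v) + c) (fderiv ℝ G ζ v) 0 :=
    HasDerivAt.add_const c ((hG ζ).hasFDerivAt.hasLineDerivAt v)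
  have h3 : HasDerivAt (fun t : ℝ => F (ξ + t • v)) (fderiv ℝ F ξ v) 0 := h1
  rw [funext h] at h3
  exact h3.unique h2

/-- A smooth family, linear in a form `ω` of positive degree and invariant at `a ∧ x` along all
`a ∧ y`, is a combination of exterior words. -/
theorem exists_wordProd_of_invariant (d : ℕ) : ∀ p : ℕ, n ≤ p + d →
    ∀ g : Form n (p + 1) →ₗ[ℝ] (((i : Fin m) → Form n (l i + 1)) → ℝ),
    (∀ ω, ContDiff ℝ (⊤ : ℕ∞) (g ω)) →
    (∀ a x y ξ, g (wedgeOne a x) (ξ + wedgeDir a y) = g (wedgeOne a x) ξ) →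
    ∃ (ι : Type) (_ : Fintype ι) (w : ι → List (Fin m))
      (L : ι → ExteriorAlgebra ℝ (Module.Dual ℝ (Eucl n)) →ₗ[ℝ] ℝ),
      ∀ ω ξ, g ω ξ = ∑ j, L j (toExt n (p + 1) ω * wordProd ξ (w j)) := by
  induction d with
  | zero =>
    intro p hp g _ _
    refine ⟨Empty, inferInstance, Empty.elim, Empty.elim, fun ω ξ => ?_⟩
    -- Here n ≤ p, so the degree p + 1 exceeds n and there are no nonzero forms.
    rw [eq_zero_of_lt (by omega) ω]
    simp
  | succ d ih =>
    intro p hp g hg hinv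
    have hdiff : ∀ ω, Differentiable ℝ (g ω) := fun ω => (hg ω).differentiable (by simp)
    -- Derivative of `g ω` in the i-th argument, bilinear in `ω` and the direction.
    let B : (i : Fin m) → Form n (p + 1) →ₗ[ℝ] Form n (l i + 1) →ₗ[ℝ]
        (((i : Fin m) → Form n (l i + 1)) → ℝ) := fun i =>
      LinearMap.mk₂ ℝ (fun ω η ξ => fderiv ℝ (g ω) ξ (Pi.single i η))
        (fun ω ω' η => by
          funext ξ
          simp only [map_add]
          rw [fderiv_add (hdiff ω ξ) (hdiff ω' ξ)]; rfl)
        (fun c ω η => by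
          funext ξ
          simp only [map_smul]
          rw [fderiv_const_smul (hdiff ω ξ)]; rfl)
        (fun ω η η' => by
          funext ξ
          simp only [Pi.single_add, map_add, Pi.add_apply])
        (fun c ω η => by
          funext ξ
          simp only [Pi.single_smul, map_smul, Pi.smul_apply])
    have hB : ∀ i ω η ξ, B i ω η ξ = fderiv ℝ (g ω) ξ (Pi.single i η) := fun i ω η ξ => rfl
    have hB0 : ∀ i a x y, B i (wedgeOne a x) (wedgeOne a y) = 0 := by
      intro i a x y
      funext ξ
      have hd : Differentiable ℝ (fun _ : (i : Fin m) → Form n (l i + 1) =>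
        g (wedgeOne a x) ξ) := differentiable_const _
      rw [hB, fderiv_eq_of_line (hdiff _) hd (c := 0) (ζ := 0) fun t => ?_]
      · simp
      · rw [single_wedgeOne, smul_wedgeDir, hinv, add_zero]
    choose G hG using fun i => exists_factor_wedge (B i) (hB0 i)
    have hGs : ∀ i ω, ContDiff ℝ (⊤ : ℕ∞) (G i ω) := by
      intro i ω
      induction ω using decomp_induction with
      | h u =>
        rw [decomp_eq_wedge, ← hG]
        exact (((hg _).fderiv_right (m := (⊤ : ℕ∞)) (by simp)).clm_apply contDiff_const)
      | h0 => rw [map_zero]; exact contDiff_const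
      | hadd x y hx hy => rw [map_add]; exact hx.add hy
      | hsmul c x hx => rw [map_smul]; exact contDiff_const.smul hx
    -- Write a ∧ z as (a ∧ x) ∧ η for decomposable z. Then `G i` at this form is the derivative of
    -- `g (wedgeOne a x)` along η, and differentiation preserves translation invariance.
    have hGinv : ∀ i a (x : Form n (p + 1 + l i)) y ξ,
        G i (wedgeOne a x) (ξ + wedgeDir a y) = G i (wedgeOne a x) ξ := by
      intro i a z y ξ
      induction z using decomp_induction with
      | h u =>
        obtain ⟨x, η, h⟩ := exists_wedgeOne_decomp_eq_wedge u
        rw [h, ← hG, hB, hB]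
        refine fderiv_eq_of_line (hdiff _) (hdiff _) (c := 0) fun t => ?_
        rw [add_right_comm, hinv, add_zero]
      | h0 => simp
      | hadd x y hx hy => simp only [map_add, Pi.add_apply, hx, hy]
      | hsmul c x hx => simp only [map_smul, Pi.smul_apply, hx]
    choose ι hι w L hL using fun i => ih (p + 1 + l i) (by omega) (G i) (hGs i) (hGinv i)
    -- `none` carries the value at ξ = 0, a linear functional of `ω` with the empty word; `some`
    -- carries the integrated words, with a letter i put in front.
    refine ⟨Option (Σ i, ι i), inferInstance,
      fun o => o.elim [] fun s => s.1 :: w s.1 s.2,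
      fun o => o.elim ((LinearMap.proj 0).comp (g.comp (ofExt n (p + 1))))
        fun s => ((w s.1 s.2).length + 1 : ℝ)⁻¹ • L s.1 s.2, fun ω ξ => ?_⟩
    rw [eq_add_sum_wordProd_of_fderiv (hdiff ω) w
      (fun i j => (L i j).comp (LinearMap.mulLeft ℝ (toExt n (p + 1) ω))) (fun ξ i η => ?_) ξ,
      Fintype.sum_option, Fintype.sum_sigma]
    · simp [wordProd, ofExt_toExt]
    · rw [← hB, hG, hL]
      refine Finset.sum_congr rfl fun j _ => ?_
      rw [LinearMap.comp_apply, LinearMap.mulLeft_apply, ← mul_assoc]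
      have hw := toExt_wedge ω η
      exact congrArg (fun z => L i j (z * wordProd ξ (w i j))) hw

/-- The hypothesis says that f(ξ + a ∧ β) - f(ξ) is constant in ξ along the directions a ∧ γ, so the
partial derivatives of `f` satisfy the invariance of `exists_wordProd_of_invariant`. -/
theorem exists_wordProd_of_contDiff {f : ((i : Fin m) → Form n (l i + 1)) → ℝ}
    (hf : ContDiff ℝ (⊤ : ℕ∞) f)
    (h : ∀ a β γ ξ, f (ξ + wedgeDir a β + wedgeDir a γ) + f ξ =
      f (ξ + wedgeDir a β) + f (ξ + wedgeDir a γ)) :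
    ∃ (ι : Type) (_ : Fintype ι) (w : ι → List (Fin m))
      (L : ι → ExteriorAlgebra ℝ (Module.Dual ℝ (Eucl n)) →ₗ[ℝ] ℝ),
      ∀ ξ, f ξ = ∑ j, L j (wordProd ξ (w j)) := by
  have hdiff : Differentiable ℝ f := hf.differentiable (by simp)
  let G : (i : Fin m) → Form n (l i + 1) →ₗ[ℝ] (((i : Fin m) → Form n (l i + 1)) → ℝ) :=
    fun i =>
    { toFun := fun η ξ => fderiv ℝ f ξ (Pi.single i η)
      map_add' := fun η η' => by
        funext ξ
        simp only [Pi.single_add, map_add, Pi.add_apply]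
      map_smul' := fun c η => by
        funext ξ
        simp only [Pi.single_smul, map_smul, Pi.smul_apply, RingHom.id_apply] }
  have hG : ∀ i η ξ, G i η ξ = fderiv ℝ f ξ (Pi.single i η) := fun _ _ _ => rfl
  choose ι hι w L hL using fun i => exists_wordProd_of_invariant (l := l) n (l i) (by omega) (G i)
    (fun η => (hf.fderiv_right (m := (⊤ : ℕ∞)) (by simp)).clm_apply contDiff_const)
    (fun a x y ξ => by
      rw [hG, hG]
      refine fderiv_eq_of_line hdiff hdiff (c := f (ξ + wedgeDir a y) - f ξ) fun t => ?_
      rw [single_wedgeOne, smul_wedgeDir]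
      have := h a y (t • Pi.single i x) ξ
      linarith)
  refine ⟨Option (Σ i, ι i), inferInstance,
    fun o => o.elim [] fun s => s.1 :: w s.1 s.2,
    fun o => o.elim (f 0 • ExteriorAlgebra.algebraMapInv.toLinearMap)
      fun s => ((w s.1 s.2).length + 1 : ℝ)⁻¹ • L s.1 s.2, fun ξ => ?_⟩
  rw [eq_add_sum_wordProd_of_fderiv hdiff w L (fun ξ i η => ?_) ξ,
    Fintype.sum_option, Fintype.sum_sigma]
  · simp [wordProd]
  · rw [← hG, hL]

end Structure

/-! ### Smoothness from separate affinity; reordering products -/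

/-- A function on `ℝ^ι` that is affine in each variable of `A` and depends only on these variables
is smooth. -/
theorem contDiff_of_affine_update {ι : Type*} [Fintype ι] [DecidableEq ι] (A : Finset ι) :
    ∀ F : (ι → ℝ) → ℝ,
    (∀ x, ∀ s ∈ A, ∀ t, F (Function.update x s t) =
      (1 - t) * F (Function.update x s 0) + t * F (Function.update x s 1)) →
    (∀ x y, (∀ s ∈ A, x s = y s) → F x = F y) → ContDiff ℝ (⊤ : ℕ∞) F := by
  induction A using Finset.induction_on with
  | empty =>
    intro F _ h
    have : F = fun _ => F 0 := funext fun x => h x 0 (by simp)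
    rw [this]
    exact contDiff_const
  | insert s A hs ih =>
    intro F haff hdep
    -- Freezing the variable `s` leaves a function of the variables in `A`, to which the induction
    -- applies; `F` interpolates between the values 0 and 1 of `s`.
    have hG : ∀ c : ℝ, ContDiff ℝ (⊤ : ℕ∞) fun x => F (Function.update x s c) := by
      intro c
      refine ih _ (fun x r hr t => ?_) fun x y hxy => ?_
      · have hne : r ≠ s := fun h => hs (h ▸ hr)
        simp only [Function.update_comm hne]
        exact haff _ r (Finset.mem_insert_of_mem hr) t
      · refine hdep _ _ fun r hr => ?_
        rcases Finset.mem_insert.1 hr with rfl | hr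
        · simp
        · have hne : r ≠ s := fun h => hs (h ▸ hr)
          simpa [hne] using hxy r hr
    have hF : F = fun x => (1 - x s) * F (Function.update x s 0) +
        x s * F (Function.update x s 1) := by
      funext x
      conv_lhs => rw [← Function.update_eq_self s x]
      exact haff x s (Finset.mem_insert_self _ _) _
    rw [hF]
    have hx : ContDiff ℝ (⊤ : ℕ∞) fun x : ι → ℝ => x s := contDiff_apply ℝ ℝ s
    exact ((contDiff_const.sub hx).mul (hG 0)).add (hx.mul (hG 1))

/-- Moving a factor into an ordered product of powers of elements that commute up to scalars. -/
theorem exists_mul_prod_pow_eq {A : Type*} [Ring A] [Algebra ℝ A] :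
    ∀ {m : ℕ} (ε : Fin m → Fin m → ℝ) (i : Fin m) (α : Fin m → ℕ),
    ∃ (c : ℝ) (β : Fin m → ℕ), ∀ x : Fin m → A, (∀ i j, x i * x j = ε i j • (x j * x i)) →
      x i * (List.ofFn fun j => x j ^ α j).prod = c • (List.ofFn fun j => x j ^ β j).prod := by
  intro m
  induction m with
  | zero => intro ε i; exact i.elim0
  | succ m ih =>
    intro ε i α
    induction i using Fin.cases with
    | zero =>
      refine ⟨1, Fin.cons (α 0 + 1) (Fin.tail α), fun x _ => ?_⟩
      simp [List.ofFn_succ, pow_succ', mul_assoc, Fin.tail]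
    | succ i =>
      obtain ⟨c, β, h⟩ := ih (fun i j => ε i.succ j.succ) i (Fin.tail α)
      -- Moving the factor past `x 0 ^ α 0` costs one commutation scalar per factor. The scalar and
      -- the exponents depend on `ε`, `i` and `α` only, never on `x`.
      refine ⟨ε i.succ 0 ^ α 0 * c, Fin.cons (α 0) β, fun x hx => ?_⟩
      have hpow : ∀ a : ℕ, x i.succ * x 0 ^ a = ε i.succ 0 ^ a • (x 0 ^ a * x i.succ) := by
        intro a
        induction a with
        | zero => simp
        | succ a iha =>
          rw [pow_succ, ← mul_assoc, iha, smul_mul_assoc, mul_assoc, hx, mul_smul_comm, smul_smul,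
            pow_succ, mul_assoc]
      have h' := h (fun j => x j.succ) fun i j => hx _ _
      simp only [Fin.tail] at h'
      simp only [List.ofFn_succ, List.prod_cons, Fin.cons_zero, Fin.cons_succ]
      rw [← mul_assoc, hpow, smul_mul_assoc, mul_assoc, h', mul_smul_comm, smul_smul]

namespace Form

variable {n p q : ℕ}

theorem mul_prod_ι_eq (a : Module.Dual ℝ (Eucl n)) (v : List (Module.Dual ℝ (Eucl n))) :
    ExteriorAlgebra.ι ℝ a * (v.map (ExteriorAlgebra.ι ℝ)).prod =
      (-1 : ℝ) ^ v.length • ((v.map (ExteriorAlgebra.ι ℝ)).prod * ExteriorAlgebra.ι ℝ a) := by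
  induction v with
  | nil => simp
  | cons b v ih =>
    have h := eq_neg_of_add_eq_zero_left (ExteriorAlgebra.ι_add_mul_swap (R := ℝ) a b)
    simp only [List.map_cons, List.prod_cons, List.length_cons]
    rw [← mul_assoc, h, neg_mul, mul_assoc, ih, mul_smul_comm, pow_succ, mul_neg_one, neg_smul,
      mul_assoc]

theorem prod_ι_mul_prod_ι_eq (u v : List (Module.Dual ℝ (Eucl n))) :
    (u.map (ExteriorAlgebra.ι ℝ)).prod * (v.map (ExteriorAlgebra.ι ℝ)).prod =
      (-1 : ℝ) ^ (u.length * v.length) •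
        ((v.map (ExteriorAlgebra.ι ℝ)).prod * (u.map (ExteriorAlgebra.ι ℝ)).prod) := by
  induction u with
  | nil => simp
  | cons a u ih =>
    simp only [List.map_cons, List.prod_cons, List.length_cons]
    rw [mul_assoc, ih, mul_smul_comm, ← mul_assoc, mul_prod_ι_eq, smul_mul_assoc, smul_smul,
      ← pow_add, mul_assoc]
    congr 2
    ring

/-- By bilinearity it suffices to treat decomposable forms, where p · q transpositions of covectors
occur. -/
theorem toExt_mul_toExt (a : Form n p) (b : Form n q) :
    toExt n p a * toExt n q b = (-1 : ℝ) ^ (p * q) • (toExt n q b * toExt n p a) := by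
  have : (LinearMap.mul ℝ (ExteriorAlgebra ℝ (Module.Dual ℝ (Eucl n)))).compl₁₂
        (toExt n p) (toExt n q) = (-1 : ℝ) ^ (p * q) •
        ((LinearMap.mul ℝ (ExteriorAlgebra ℝ (Module.Dual ℝ (Eucl n)))).flip.compl₁₂
        (toExt n p) (toExt n q)) :=
    linearMap_ext fun u => linearMap_ext fun w => by
      have h := prod_ι_mul_prod_ι_eq (List.ofFn u) (List.ofFn w)
      simp only [List.length_ofFn, List.map_ofFn] at h
      simpa [toExt_decomp, ExteriorAlgebra.ιMulti_apply, Function.comp_def] using h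
  exact LinearMap.congr_fun₂ this a b

/-- Expansion of a form in the basis of decomposable forms. -/
theorem eq_sum_decomp (ζ : Form n p) :
    ζ = ∑ I : Fin p → Fin n, ((p.factorial : ℝ)⁻¹ *
      ζ (fun i => EuclideanSpace.single (I i) (1 : ℝ))) •
        decomp n p fun i => dcoord n (I i) := by
  conv_lhs => rw [← liftDecomp_decomp_self ζ, liftDecomp_apply, Finset.smul_sum]
  simp only [smul_smul]

end Form

/-! ### Vectorially ext. one affine functions are exterior polynomials -/

section Structure

variable {n m : ℕ} {l : Fin m → ℕ} {f : ((i : Fin m) → Form n (l i + 1)) → ℝ}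

theorem VectoriallyExtOneAffine.exists_affine (hf : VectoriallyExtOneAffine f)
    (ξ : (i : Fin m) → Form n (l i + 1)) (a : Form n 1) (β : (i : Fin m) → Form n (l i)) (t : ℝ) :
    f (ξ + t • wedgeDir a β) = (1 - t) * f ξ + t * f (ξ + wedgeDir a β) := by
  obtain ⟨c, d, h⟩ := hf ξ a β
  have h' : ∀ t : ℝ, f (ξ + t • wedgeDir a β) = c + d * t := h
  have h0 := h' 0
  have h1 := h' 1
  simp only [zero_smul, add_zero, mul_zero, one_smul, mul_one] at h0 h1
  rw [h', h0, h1]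
  ring

/-- The four points form a parallelogram whose diagonals are both of the form a ∧ (·). Affinity
along each diagonal gives two expressions for the value at the common midpoint. -/
theorem VectoriallyExtOneAffine.add_add (hf : VectoriallyExtOneAffine f) (a : Form n 1)
    (β γ : (i : Fin m) → Form n (l i)) (ξ : (i : Fin m) → Form n (l i + 1)) :
    f (ξ + wedgeDir a β + wedgeDir a γ) + f ξ =
      f (ξ + wedgeDir a β) + f (ξ + wedgeDir a γ) := by
  have h1 := hf.exists_affine ξ a (β + γ) (1 / 2)
  have h2 := hf.exists_affine (ξ + wedgeDir a β) a (γ - β) (1 / 2)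
  have e1 : ξ + wedgeDir a (β + γ) = ξ + wedgeDir a β + wedgeDir a γ := by
    rw [← add_wedgeDir, add_assoc]
  have e2 : ξ + wedgeDir a β + wedgeDir a (γ - β) = ξ + wedgeDir a γ := by
    rw [add_assoc, add_wedgeDir, add_sub_cancel]
  have e3 : ξ + wedgeDir a β + (1 / 2 : ℝ) • wedgeDir a (γ - β) =
      ξ + (1 / 2 : ℝ) • wedgeDir a (β + γ) := by
    rw [smul_wedgeDir, smul_wedgeDir, add_assoc, add_wedgeDir]
    congr 2
    module
  rw [e1] at h1
  rw [e2, e3] at h2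
  linarith

/-- Each monomial of covectors is some a ∧ β, so `f` is affine in every coefficient. All index
tuples are allowed, so the coordinates are redundant; `Ψ` is a linear section of the parametrization
`Φ`. -/
theorem VectoriallyExtOneAffine.contDiff (hf : VectoriallyExtOneAffine f) :
    ContDiff ℝ (⊤ : ℕ∞) f := by
  classical
  let e : (Σ i : Fin m, (Fin (l i + 1) → Fin n)) → (i : Fin m) → Form n (l i + 1) := fun s =>
    Pi.single s.1 (decomp n (l s.1 + 1) fun j => dcoord n (s.2 j))
  let Φ : ((Σ i : Fin m, (Fin (l i + 1) → Fin n)) → ℝ) →ₗ[ℝ] (i : Fin m) → Form n (l i + 1) :=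
    Fintype.linearCombination ℝ e
  let Ψ : ((i : Fin m) → Form n (l i + 1)) →ₗ[ℝ] ((Σ i : Fin m, (Fin (l i + 1) → Fin n)) → ℝ) :=
    { toFun := fun ξ s => (((l s.1 + 1).factorial : ℝ)⁻¹ *
        ξ s.1 (fun j => EuclideanSpace.single (s.2 j) (1 : ℝ)))
      map_add' := fun ξ η => by funext s; simp [mul_add]
      map_smul' := fun c ξ => by funext s; simp [mul_left_comm] }
  have hΦΨ : ∀ ξ, Φ (Ψ ξ) = ξ := by
    intro ξ
    rw [Fintype.linearCombination_apply, Fintype.sum_sigma]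
    conv_rhs => rw [← Finset.univ_sum_single ξ]
    refine Finset.sum_congr rfl fun i _ => ?_
    conv_rhs => rw [eq_sum_decomp (ξ i)]
    rw [← LinearMap.single_apply (R := ℝ), map_sum]
    refine Finset.sum_congr rfl fun I _ => ?_
    rw [map_smul]
    rfl
  have hF : ContDiff ℝ (⊤ : ℕ∞) fun x => f (Φ x) := by
    refine contDiff_of_affine_update Finset.univ _ (fun x s _ t => ?_)
      fun x y h => by rw [funext fun s => h s (Finset.mem_univ s)]
    have hupd : ∀ t, Φ (Function.update x s t) = Φ (Function.update x s 0) + t • e s := by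
      intro t
      have : Function.update x s t = Function.update x s 0 + t • Pi.single s (1 : ℝ) := by
        funext r
        by_cases h : r = s
        · subst h; simp
        · simp [h]
      rw [this, map_add, map_smul]
      congr 2
      simp [Φ, Fintype.linearCombination_apply_single]
    obtain ⟨β, hβ⟩ := exists_decomp_eq_wedgeOne (fun j => dcoord n (s.2 j)) 0
    have he : e s = wedgeDir (decomp n 1 fun _ => dcoord n (s.2 0)) (Pi.single s.1 β) := by
      rw [← single_wedgeOne, ← hβ]
    rw [hupd t, hupd 1, he, hf.exists_affine, one_smul]
  have hcomp : f = (fun x => f (Φ x)) ∘ Ψ := by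
    funext ξ
    simp [hΦΨ]
  rw [hcomp]
  exact hF.comp (LinearMap.toContinuousLinearMap Ψ).contDiff

/-- Graded commutativity sorts the letters of a word at the price of a scalar independent of ξ. -/
theorem exists_wordProd_eq_smul (w : List (Fin m)) : ∃ (c : ℝ) (α : Fin m → ℕ),
    ∀ ξ : (i : Fin m) → Form n (l i + 1),
      wordProd ξ w = c • toExt n (∑ i, (l i + 1) * α i) (wedgeMultiPow ξ α) := by
  simp only [toExt_wedgeMultiPow]
  induction w with
  | nil => exact ⟨1, 0, fun ξ => by simp [wordProd]⟩
  | cons i w ih =>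
    obtain ⟨c, α, h⟩ := ih
    obtain ⟨d, β, h'⟩ := exists_mul_prod_pow_eq
      (A := ExteriorAlgebra ℝ (Module.Dual ℝ (Eucl n)))
      (fun i j => (-1 : ℝ) ^ ((l i + 1) * (l j + 1))) i α
    refine ⟨c * d, β, fun ξ => ?_⟩
    have h1 : wordProd ξ (i :: w) = toExt n (l i + 1) (ξ i) * wordProd ξ w := by simp [wordProd]
    rw [h1, h, mul_smul_comm, h' (fun i => toExt n (l i + 1) (ξ i))
      fun i j => toExt_mul_toExt _ _, smul_smul]

theorem mem_multiIndices {k : Fin m → ℕ} (hk : ∀ i, 0 < k i) {α : Fin m → ℕ}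
    (h : ∑ i, k i * α i ≤ n) : α ∈ multiIndices n k := by
  refine Finset.mem_filter.2 ⟨Fintype.mem_piFinset.2 fun i => ?_, h⟩
  have h1 : k i * α i ≤ n :=
    (Finset.single_le_sum (f := fun i => k i * α i) (fun _ _ => Nat.zero_le _)
      (Finset.mem_univ i)).trans h
  rw [Finset.mem_range, Nat.lt_succ_iff, Nat.le_div_iff_mul_le (hk i), mul_comm]
  exact h1

/-- A vectorially ext. one affine function is a combination of exterior monomials. -/
theorem VectoriallyExtOneAffine.exists_eq_sum (hf : VectoriallyExtOneAffine f) :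
    ∃ c : (α : Fin m → ℕ) → Form n (∑ i, (l i + 1) * α i),
      ∀ ξ : (i : Fin m) → Form n (l i + 1),
        f ξ = ∑ α ∈ multiIndices n (fun i => l i + 1),
          pairing (c α) (wedgeMultiPow ξ α) := by
  classical
  obtain ⟨ι, _, w, L, h⟩ := exists_wordProd_of_contDiff hf.contDiff fun a β γ ξ => hf.add_add a β γ ξ
  choose r α hα using fun j => exists_wordProd_eq_smul (n := n) (l := l) (w j)
  -- All words sorting to the same multi-index are merged into one functional, represented by the
  -- coefficient `c γ`.
  have hex : ∀ γ : Fin m → ℕ, ∃ c : Form n (∑ i, (l i + 1) * γ i), ∀ ζ,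
      (∑ j, if α j = γ then r j • (L j).comp (toExt n (∑ i, (l i + 1) * γ i)) else 0) ζ =
        pairing c ζ := fun γ => exists_pairing_eq _
  choose c hc using hex
  refine ⟨c, fun ξ => ?_⟩
  simp only [← hc, LinearMap.sum_apply]
  rw [Finset.sum_comm, h]
  refine Finset.sum_congr rfl fun j _ => ?_
  rw [hα]
  by_cases hj : ∑ i, (l i + 1) * α j i ≤ n
  · rw [Finset.sum_eq_single_of_mem (α j) (mem_multiIndices (fun i => Nat.succ_pos _) hj)
      fun γ _ hγ => by rw [if_neg hγ.symm, LinearMap.zero_apply], if_pos rfl]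
    simp
  -- A word of degree above n vanishes, and its multi-index does not occur on the right.
  · rw [eq_zero_of_lt (not_le.1 hj) (wedgeMultiPow ξ (α j)), map_zero, smul_zero, map_zero]
    refine (Finset.sum_eq_zero fun γ hγ => ?_).symm
    rw [if_neg, LinearMap.zero_apply]
    rintro rfl
    exact hj (Finset.mem_filter.1 hγ).2

end Structure

/-! ### Square and triangular waves -/

section SquareWave

/-- The square wave `±1` of period one; it changes its sign under translation by `1 / 2`. -/
def squareWave (t : ℝ) : ℝ := if Int.fract t < 1 / 2 then 1 else -1

/-- The triangular wave, the distance to the nearest integer. -/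
def triangleWave (t : ℝ) : ℝ := |t - round t|

theorem measurable_squareWave : Measurable squareWave :=
  Measurable.ite (measurableSet_lt measurable_fract measurable_const) measurable_const
    measurable_const

theorem squareWave_eq_or (t : ℝ) : squareWave t = 1 ∨ squareWave t = -1 := by
  unfold squareWave; split_ifs <;> simp

theorem abs_squareWave (t : ℝ) : |squareWave t| = 1 := by
  rcases squareWave_eq_or t with h | h <;> simp [h]

theorem squareWave_add_half (t : ℝ) : squareWave (t + 1 / 2) = -squareWave t := by
  unfold squareWave
  have h0 := Int.fract_nonneg t
  have h1 := Int.fract_lt_one t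
  have ht := Int.floor_add_fract t
  by_cases h : Int.fract t < 1 / 2
  · have : Int.fract (t + 1 / 2) = Int.fract t + 1 / 2 :=
      Int.fract_eq_iff.2 ⟨by linarith, by linarith, ⌊t⌋, by linarith⟩
    rw [if_pos h, this, if_neg (by linarith)]
  · have : Int.fract (t + 1 / 2) = Int.fract t - 1 / 2 :=
      Int.fract_eq_iff.2 ⟨by linarith, by linarith, ⌊t⌋ + 1, by push_cast; linarith⟩
    rw [if_neg h, this, if_pos (by linarith), neg_neg]

theorem lipschitzWith_triangleWave : LipschitzWith 1 triangleWave :=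
  LipschitzWith.of_le_add fun x y => by
    unfold triangleWave
    have h1 := round_le x (round y)
    have h2 := abs_sub_abs_le_abs_sub (x - round y) (y - round y)
    rw [sub_sub_sub_cancel_right] at h2
    rw [Real.dist_eq]
    linarith

theorem abs_triangleWave_le (t : ℝ) : |triangleWave t| ≤ 1 := by
  unfold triangleWave
  rw [abs_abs]
  linarith [abs_sub_round t]

/-- Away from the corners at the half-integers, the wave is t - ⌊t⌋ on the first half of a period
and ⌊t⌋ + 1 - t on the second. -/
theorem hasDerivAt_triangleWave {t : ℝ} (ht : ∀ k : ℤ, 2 * t ≠ k) :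
    HasDerivAt triangleWave (squareWave t) t := by
  have hf := Int.floor_add_fract t
  have h0 : 0 < Int.fract t := by
    refine (Int.fract_nonneg t).lt_of_ne fun h => ht (2 * ⌊t⌋) ?_
    push_cast; linarith
  have h1 := Int.fract_lt_one t
  have hne : Int.fract t ≠ 1 / 2 := fun h => ht (2 * ⌊t⌋ + 1) (by push_cast; linarith)
  unfold squareWave
  rcases hne.lt_or_gt with h | h
  · rw [if_pos h]
    refine ((hasDerivAt_id t).sub_const (⌊t⌋ : ℝ)).congr_of_eventuallyEq ?_
    filter_upwards [Ioo_mem_nhds (a := (⌊t⌋ : ℝ)) (b := ⌊t⌋ + 1 / 2) (by linarith) (by linarith)]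
      with s hs
    have : Int.fract s = s - ⌊t⌋ :=
      Int.fract_eq_iff.2 ⟨by linarith [hs.1], by linarith [hs.2], ⌊t⌋, by ring⟩
    rw [triangleWave, abs_sub_round_eq_min, this, min_eq_left (by linarith [hs.2])]
    rfl
  · rw [if_neg (by linarith)]
    have hd : HasDerivAt (fun s : ℝ => (⌊t⌋ : ℝ) + 1 - s) (-1) t := by
      simpa using (hasDerivAt_id t).const_sub ((⌊t⌋ : ℝ) + 1)
    refine hd.congr_of_eventuallyEq ?_
    filter_upwards [Ioo_mem_nhds (a := (⌊t⌋ : ℝ) + 1 / 2) (b := ⌊t⌋ + 1) (by linarith)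
      (by linarith)] with s hs
    have : Int.fract s = s - ⌊t⌋ :=
      Int.fract_eq_iff.2 ⟨by linarith [hs.1], by linarith [hs.2], ⌊t⌋, by ring⟩
    rw [triangleWave, abs_sub_round_eq_min, this, min_eq_right (by linarith [hs.1])]
    ring

end SquareWave

/-! ### Weak-* limits of rapid oscillations -/

section Oscillation

variable {n : ℕ}

theorem exists_apply_eq_one {c : Module.Dual ℝ (Eucl n)} (hc : c ≠ 0) : ∃ w, c w = 1 := by
  obtain ⟨w, hw⟩ : ∃ w, c w ≠ 0 := by
    by_contra! h
    exact hc (LinearMap.ext h)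
  exact ⟨(c w)⁻¹ • w, by simp [hw]⟩

theorem volume_hyperplane {c : Module.Dual ℝ (Eucl n)} (hc : c ≠ 0) (r : ℝ) :
    volume {x | c x = r} = 0 := by
  obtain ⟨w, hw⟩ := exists_apply_eq_one hc
  have h1 : {x | c x = r} = (fun x => x + -(r • w)) ⁻¹' (LinearMap.ker c : Set (Eucl n)) := by
    ext x
    simp [hw, add_neg_eq_zero]
  rw [h1, measure_preimage_add_right]
  refine Measure.addHaar_submodule _ _ fun h => hc (LinearMap.ker_eq_top.1 h)

/-- Continuity of translations in L¹. -/
theorem tendsto_integral_norm_sub_translate {g : Eucl n → ℝ} (hg : Integrable g)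
    {h : ℕ → Eucl n} (hh : Tendsto h atTop (𝓝 0)) :
    Tendsto (fun k => ∫ x, ‖g (x + h k) - g x‖) atTop (𝓝 0) := by
  let G : C(Eucl n, C(Eucl n, Eucl n)) :=
    (ContinuousMap.mk (fun z : Eucl n × Eucl n => z.2 + z.1) (by fun_prop)).curry
  have hG : ∀ y, MeasurePreserving (G y) volume volume := fun y =>
    measurePreserving_add_right volume y
  have h1 := Filter.Tendsto.compMeasurePreservingLp (l := atTop) (p := 1)
    (f := fun _ : ℕ => hg.toL1 g) (f₀ := hg.toL1 g) (g := fun k => G (h k)) (g₀ := G 0)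
    tendsto_const_nhds ((G.continuous.tendsto 0).comp hh) (fun k => hG _) (hG 0) (by simp)
  rw [tendsto_iff_norm_sub_tendsto_zero] at h1
  refine h1.congr fun k => ?_
  rw [L1.norm_eq_integral_norm]
  refine integral_congr_ae ?_
  have hcomp : ∀ y, (Lp.compMeasurePreserving (G y) (hG y) (hg.toL1 g) : Eucl n → ℝ) =ᵐ[volume]
      fun x => g (x + y) := fun y =>
    (Lp.coeFn_compMeasurePreserving (hg.toL1 g) (hG y)).trans
      ((hG y).quasiMeasurePreserving.ae_eq_comp hg.coeFn_toL1)
  filter_upwards [hcomp (h k), hcomp 0, Lp.coeFn_sub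
    (Lp.compMeasurePreserving (G (h k)) (hG (h k)) (hg.toL1 g))
    (Lp.compMeasurePreserving (G 0) (hG 0) (hg.toL1 g))] with x hx1 hx2 hx3
  rw [hx3, Pi.sub_apply, hx1, hx2, add_zero]

/-- Rapidly oscillating square waves tend to zero weakly-* in `L^∞`. -/
theorem tendsto_integral_squareWave {c : Module.Dual ℝ (Eucl n)} (hc : c ≠ 0) {g : Eucl n → ℝ}
    (hg : Integrable g) :
    Tendsto (fun k : ℕ => ∫ x, squareWave ((k + 1 : ℝ) * c x) * g x) atTop (𝓝 0) := by
  obtain ⟨w, hw⟩ := exists_apply_eq_one hc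
  have hcc : Continuous c := c.continuous_of_finiteDimensional
  -- This shift moves the phase (k+1) c x by exactly half a period, which flips the sign of the
  -- wave.
  let h : ℕ → Eucl n := fun k => (1 / ((k : ℝ) + 1)) • ((1 / 2 : ℝ) • w)
  have hh : Tendsto h atTop (𝓝 0) := by
    simpa [h] using (tendsto_one_div_add_atTop_nhds_zero_nat (𝕜 := ℝ)).smul_const ((1 / 2 : ℝ) • w)
  have hlim := tendsto_integral_norm_sub_translate hg hh
  refine squeeze_zero_norm (fun k => ?_) hlim
  have hmeas : ∀ k : ℕ, Measurable fun x => squareWave ((k + 1 : ℝ) * c x) := fun k =>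
    measurable_squareWave.comp ((hcc.measurable).const_mul _)
  have hint : ∀ u : Eucl n → ℝ, Integrable u →
      Integrable fun x => squareWave ((k + 1 : ℝ) * c x) * u x := fun u hu =>
    hu.bdd_mul (c := 1) (hmeas k).aestronglyMeasurable
      (Eventually.of_forall fun x => (abs_squareWave _).le)
  have hshift : Integrable fun x => g (x + h k) := hg.comp_add_right (h k)
  have hk : (k + 1 : ℝ) ≠ 0 := by positivity
  have h1 : ∫ x, squareWave ((k + 1 : ℝ) * c x) * g x =
      -∫ x, squareWave ((k + 1 : ℝ) * c x) * g (x + h k) := by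
    rw [← integral_add_right_eq_self _ (h k), ← integral_neg]
    refine integral_congr_ae (Eventually.of_forall fun x => ?_)
    have : (k + 1 : ℝ) * c (x + h k) = (k + 1 : ℝ) * c x + 1 / 2 := by
      simp only [h, map_add, map_smul, hw, smul_eq_mul]
      field_simp
    simp only [this, squareWave_add_half, neg_mul]
  -- Adding the original and shifted integrals leaves only g(x + h) - g(x), which is small in L¹.
  have h2 : 2 * ∫ x, squareWave ((k + 1 : ℝ) * c x) * g x =
      -∫ x, squareWave ((k + 1 : ℝ) * c x) * (g (x + h k) - g x) := by
    simp only [mul_sub]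
    rw [integral_sub (hint _ hshift) (hint _ hg)]
    linarith
  have h3 : ‖∫ x, squareWave ((k + 1 : ℝ) * c x) * (g (x + h k) - g x)‖ ≤
      ∫ x, ‖g (x + h k) - g x‖ := by
    refine (norm_integral_le_integral_norm _).trans_eq ?_
    refine integral_congr_ae (Eventually.of_forall fun x => ?_)
    simp only [norm_mul, Real.norm_eq_abs, abs_squareWave, one_mul]
  rw [← norm_neg, ← h2, norm_mul] at h3
  norm_num at h3 ⊢
  linarith [abs_nonneg (∫ x, squareWave ((k + 1 : ℝ) * c x) * g x)]

theorem tendsto_setIntegral_squareWave {c : Module.Dual ℝ (Eucl n)} (hc : c ≠ 0)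
    {s : Set (Eucl n)} (hs : MeasurableSet s) {g : Eucl n → ℝ} (hg : IntegrableOn g s) :
    Tendsto (fun k : ℕ => ∫ x in s, squareWave ((k + 1 : ℝ) * c x) * g x) atTop (𝓝 0) := by
  refine (tendsto_integral_squareWave hc (hg.integrable_indicator hs)).congr fun k => ?_
  rw [← integral_indicator hs]
  refine integral_congr_ae (Eventually.of_forall fun x => ?_)
  by_cases hx : x ∈ s <;> simp [hx]

/-- The oscillating potential `x ↦ T ((k + 1) c x) / (k + 1)`. -/
def oscPotential (c : Module.Dual ℝ (Eucl n)) (k : ℕ) (x : Eucl n) : ℝ :=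
  ((k : ℝ) + 1)⁻¹ * triangleWave ((k + 1 : ℝ) * c x)

theorem exists_lipschitzWith_dual (c : Module.Dual ℝ (Eucl n)) : ∃ C, LipschitzWith C c :=
  ⟨_, (LinearMap.toContinuousLinearMap c).lipschitz⟩

theorem exists_lipschitzWith_oscPotential (c : Module.Dual ℝ (Eucl n)) (k : ℕ) :
    ∃ C, LipschitzWith C (oscPotential c k) := by
  obtain ⟨C, hC⟩ := exists_lipschitzWith_dual (((k : ℝ) + 1) • c)
  exact ⟨_, ((lipschitzWith_smul (((k : ℝ) + 1)⁻¹)).comp lipschitzWith_triangleWave).comp hC⟩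

theorem abs_oscPotential_le (c : Module.Dual ℝ (Eucl n)) (k : ℕ) (x : Eucl n) :
    |oscPotential c k x| ≤ 1 / ((k : ℝ) + 1) := by
  rw [oscPotential, abs_mul, abs_of_pos (by positivity), one_div]
  exact mul_le_of_le_one_right (by positivity) (abs_triangleWave_le _)

/-- The corners lie on countably many parallel hyperplanes, a null set. Off it the frequency k + 1
cancels the amplitude 1/(k + 1). -/
theorem ae_lineDeriv_oscPotential {c : Module.Dual ℝ (Eucl n)} (hc : c ≠ 0) (k : ℕ) :
    ∀ᵐ x, ∀ v, lineDeriv ℝ (oscPotential c k) x v = squareWave ((k + 1 : ℝ) * c x) * c v := by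
  have hk : (k + 1 : ℝ) ≠ 0 := by positivity
  have h : ∀ᵐ x, ∀ j : ℤ, c x ≠ j / (2 * (k + 1)) := by
    rw [ae_all_iff]
    intro j
    rw [ae_iff]
    simpa using volume_hyperplane hc (j / (2 * (k + 1)))
  filter_upwards [h] with x hx v
  refine HasLineDerivAt.lineDeriv ?_
  have h1 : HasDerivAt triangleWave (squareWave ((k + 1 : ℝ) * c x))
      ((k + 1 : ℝ) * (c x + 0 * c v)) := by
    rw [zero_mul, add_zero]
    refine hasDerivAt_triangleWave fun j hj => hx j ?_
    rw [← hj]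
    field_simp
  have h2 : HasDerivAt (fun t : ℝ => (k + 1 : ℝ) * (c x + t * c v)) ((k + 1 : ℝ) * c v) 0 := by
    simpa using (((hasDerivAt_id (0 : ℝ)).mul_const (c v)).const_add (c x)).const_mul (k + 1 : ℝ)
  have h3 := (h1.comp (0 : ℝ) h2).const_mul ((k + 1 : ℝ)⁻¹)
  have h4 : HasDerivAt (fun t : ℝ => oscPotential c k (x + t • v))
      ((k + 1 : ℝ)⁻¹ * (squareWave ((k + 1 : ℝ) * c x) * ((k + 1 : ℝ) * c v))) 0 := by
    refine h3.congr_of_eventuallyEq (Eventually.of_forall fun t => ?_)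
    simp [oscPotential]
  refine h4.congr_deriv ?_
  field_simp

end Oscillation

namespace Form

variable {n p : ℕ}

theorem exists_eq_decomp_one (a : Form n 1) :
    ∃ c : Module.Dual ℝ (Eucl n), a = decomp n 1 fun _ => c := by
  have key : ∀ (c : Module.Dual ℝ (Eucl n)) v, decomp n 1 (fun _ => c) v = c (v 0) :=
    fun c v => by simp [decomp_apply]
  induction a using decomp_induction with
  | h u => exact ⟨u 0, by congr 1; funext i; rw [Subsingleton.elim i 0]⟩
  | h0 => exact ⟨0, by ext v; simp [key]⟩
  | hadd x y hx hy =>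
    obtain ⟨c, rfl⟩ := hx
    obtain ⟨d, rfl⟩ := hy
    exact ⟨c + d, by ext v; simp [key]⟩
  | hsmul r x hx =>
    obtain ⟨c, rfl⟩ := hx
    exact ⟨r • c, by ext v; simp [key]⟩

/-- Laplace expansion of the determinant along the row of `c`, extended linearly from decomposable
β. The sum matches the one in `IsWeakExtDeriv`. -/
theorem wedgeOne_decomp_apply (c : Module.Dual ℝ (Eucl n)) (β : Form n p)
    (v : Fin (p + 1) → Eucl n) :
    wedgeOne (decomp n 1 fun _ => c) β v =
      ∑ i : Fin (p + 1), (-1 : ℝ) ^ (i : ℕ) * c (v i) * β (i.removeNth v) := by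
  induction β using decomp_induction with
  | h u =>
    rw [wedgeOne_decomp, decomp_apply, Matrix.det_succ_row_zero]
    refine Finset.sum_congr rfl fun i _ => ?_
    rw [decomp_apply]
    rfl
  | h0 => simp
  | hadd x y hx hy => simp [hx, hy, mul_add, Finset.sum_add_distrib]
  | hsmul r x hx => simp [hx, Finset.mul_sum, mul_left_comm]

end Form

/-! ### Weak exterior derivatives and potentials -/

section WeakDerivative

variable {n p : ℕ} {Ω : Opens (Eucl n)}

theorem TestFunction.apply_eq_zero (φ : TestFunction Ω ℝ ⊤) {x : Eucl n}
    (hx : x ∉ (Ω : Set (Eucl n))) : φ x = 0 :=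
  image_eq_zero_of_notMem_tsupport fun h => hx (φ.tsupport_subset h)

theorem TestFunction.fderiv_eq_zero (φ : TestFunction Ω ℝ ⊤) {x : Eucl n}
    (hx : x ∉ (Ω : Set (Eucl n))) : fderiv ℝ φ x = 0 :=
  image_eq_zero_of_notMem_tsupport fun h => hx (φ.tsupport_subset (tsupport_fderiv_subset ℝ h))

theorem TestFunction.integrable_volume (φ : TestFunction Ω ℝ ⊤) : Integrable φ :=
  φ.continuous.integrable_of_hasCompactSupport φ.hasCompactSupport

theorem TestFunction.continuous_fderiv_apply (φ : TestFunction Ω ℝ ⊤) (v : Eucl n) :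
    Continuous fun x => fderiv ℝ φ x v :=
  (φ.contDiff.continuous_fderiv (by simp)).clm_apply continuous_const

theorem TestFunction.hasCompactSupport_fderiv_apply (φ : TestFunction Ω ℝ ⊤) (v : Eucl n) :
    HasCompactSupport fun x => fderiv ℝ φ x v :=
  φ.hasCompactSupport.fderiv_apply (𝕜 := ℝ) v

/-- Integration by parts of a Lipschitz function against a test function. -/
theorem integral_lineDeriv_mul_testFunction {u : Eucl n → ℝ} {C : NNReal} (hu : LipschitzWith C u)
    (φ : TestFunction Ω ℝ ⊤) (v : Eucl n) :
    ∫ x, lineDeriv ℝ u x v * φ x = -∫ x, fderiv ℝ φ x v * u x := by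
  obtain ⟨D, hD⟩ := φ.contDiff.lipschitzWith_of_hasCompactSupport φ.hasCompactSupport (by simp)
  rw [hu.integral_lineDeriv_mul_eq hD φ.hasCompactSupport, ← integral_neg]
  refine integral_congr_ae (Eventually.of_forall fun x => ?_)
  have hd : DifferentiableAt ℝ φ x := (φ.contDiff.differentiable (by simp)) x
  simp only [hd.lineDeriv_eq_fderiv, map_neg, neg_mul]

/-- The weak exterior derivative `d(u β) = du ∧ β` for `u` Lipschitz and `β` constant. -/
theorem isWeakExtDeriv_smul {u s : Eucl n → ℝ} {C : NNReal} (hu : LipschitzWith C u)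
    {c : Module.Dual ℝ (Eucl n)} (hs : ∀ᵐ x, ∀ v, lineDeriv ℝ u x v = s x * c v)
    (β : Form n p) :
    IsWeakExtDeriv Ω (fun x => u x • β) (fun x => s x • wedgeOne (decomp n 1 fun _ => c) β) := by
  intro φ v
  -- The test function and its derivative vanish off Ω, so both integrals extend to the whole space,
  -- where integration by parts applies.
  rw [setIntegral_eq_integral_of_forall_compl_eq_zero fun x hx => by
      rw [φ.apply_eq_zero hx, zero_mul],
    setIntegral_eq_integral_of_forall_compl_eq_zero fun x hx => by
      simp [φ.fderiv_eq_zero hx]]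
  have h1 : ∫ x, φ x * (s x • wedgeOne (decomp n 1 fun _ => c) β) v =
      ∫ x, ∑ i : Fin (p + 1), ((-1 : ℝ) ^ (i : ℕ) * β (i.removeNth v)) *
        (lineDeriv ℝ u x (v i) * φ x) := by
    refine integral_congr_ae ?_
    filter_upwards [hs] with x hx
    rw [ContinuousAlternatingMap.smul_apply, wedgeOne_decomp_apply, smul_eq_mul, Finset.mul_sum,
      Finset.mul_sum]
    refine Finset.sum_congr rfl fun i _ => ?_
    rw [hx]
    ring
  have h2 : ∫ x, ∑ i : Fin (p + 1), (-1 : ℝ) ^ (i : ℕ) * fderiv ℝ φ x (v i) *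
        (u x • β) (i.removeNth v) =
      ∫ x, ∑ i : Fin (p + 1), ((-1 : ℝ) ^ (i : ℕ) * β (i.removeNth v)) *
        (fderiv ℝ φ x (v i) * u x) := by
    refine integral_congr_ae (Eventually.of_forall fun x => Finset.sum_congr rfl fun i _ => ?_)
    rw [ContinuousAlternatingMap.smul_apply, smul_eq_mul]
    ring
  rw [h1, h2, integral_finsetSum _ fun i _ => ?_, integral_finsetSum _ fun i _ => ?_,
    ← Finset.sum_neg_distrib]
  · refine Finset.sum_congr rfl fun i _ => ?_
    rw [integral_const_mul, integral_const_mul, integral_lineDeriv_mul_testFunction hu, mul_neg]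
  · refine Integrable.const_mul ?_ _
    exact ((φ.continuous_fderiv_apply (v i)).mul hu.continuous).integrable_of_hasCompactSupport
      ((φ.hasCompactSupport_fderiv_apply (v i)).mul_right)
  · refine Integrable.const_mul ?_ _
    exact (hu.locallyIntegrable_lineDeriv (v i)).integrable_smul_right_of_hasCompactSupport
      φ.continuous φ.hasCompactSupport

theorem memWdInfty_smul (hΩ : Bornology.IsBounded (Ω : Set (Eucl n))) {u s : Eucl n → ℝ}
    {C : NNReal} (hu : LipschitzWith C u) {c : Module.Dual ℝ (Eucl n)}
    (hs : ∀ᵐ x, ∀ v, lineDeriv ℝ u x v = s x * c v) (hsm : Measurable s)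
    (hs1 : ∀ x, |s x| ≤ 1) (β : Form n p) :
    MemWdInfty Ω (fun x => u x • β) (fun x => s x • wedgeOne (decomp n 1 fun _ => c) β) := by
  refine ⟨?_, ?_, isWeakExtDeriv_smul hu hs β⟩
  · obtain ⟨R, hR⟩ := (hu.isBounded_image hΩ).exists_norm_le
    refine memLp_top_of_bound
      (hu.continuous.smul continuous_const).aestronglyMeasurable (R * ‖β‖) ?_
    filter_upwards [ae_restrict_mem Ω.isOpen.measurableSet] with x hx
    rw [norm_smul]
    exact mul_le_mul_of_nonneg_right (hR _ ⟨x, hx, rfl⟩) (norm_nonneg _)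
  · refine memLp_top_of_bound (hsm.aestronglyMeasurable.smul_const _)
      ‖wedgeOne (decomp n 1 fun _ => c) β‖ (Eventually.of_forall fun x => ?_)
    rw [norm_smul]
    exact mul_le_of_le_one_left (norm_nonneg _) (hs1 x)

theorem MeasureTheory.MemLp.form_apply {μ : Measure (Eucl n)} {ω : Eucl n → Form n p}
    (h : MemLp ω ∞ μ) (v : Fin p → Eucl n) : MemLp (fun x => ω x v) ∞ μ := by
  let L : Form n p →ₗ[ℝ] ℝ :=
    { toFun := fun ζ => ζ v, map_add' := fun _ _ => rfl, map_smul' := fun _ _ => rfl }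
  exact (LinearMap.toContinuousLinearMap L).comp_memLp' h

theorem MemWdInfty.integrable_left {ω : Eucl n → Form n p} {η : Eucl n → Form n (p + 1)}
    (h : MemWdInfty Ω ω η) (φ : TestFunction Ω ℝ ⊤) (v : Fin (p + 1) → Eucl n) :
    Integrable (fun x => φ x * η x v) (volume.restrict (Ω : Set (Eucl n))) :=
  φ.integrable_volume.restrict.mul_of_top_left (h.memLp_deriv.form_apply v)

theorem MemWdInfty.integrable_right {ω : Eucl n → Form n p} {η : Eucl n → Form n (p + 1)}
    (h : MemWdInfty Ω ω η) (φ : TestFunction Ω ℝ ⊤) (v : Fin (p + 1) → Eucl n) :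
    Integrable (fun x => ∑ i : Fin (p + 1), (-1 : ℝ) ^ (i : ℕ) * fderiv ℝ φ x (v i) *
      ω x (i.removeNth v)) (volume.restrict (Ω : Set (Eucl n))) := by
  refine integrable_finsetSum _ fun i _ => Integrable.mul_of_top_left ?_ (h.memLp.form_apply _)
  exact (((φ.continuous_fderiv_apply (v i)).integrable_of_hasCompactSupport
    (φ.hasCompactSupport_fderiv_apply (v i))).const_mul _).restrict

theorem memLp_top_fun_add {α E : Type*} [MeasurableSpace α] {μ : Measure α}
    [NormedAddCommGroup E] {f g : α → E} (hf : MemLp f ∞ μ) (hg : MemLp g ∞ μ) :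
    MemLp (fun x => f x + g x) ∞ μ :=
  hf.add hg

theorem MemWdInfty.add {ω ω' : Eucl n → Form n p} {η η' : Eucl n → Form n (p + 1)}
    (h : MemWdInfty Ω ω η) (h' : MemWdInfty Ω ω' η') :
    MemWdInfty Ω (fun x => ω x + ω' x) (fun x => η x + η' x) := by
  refine ⟨memLp_top_fun_add h.memLp h'.memLp, memLp_top_fun_add h.memLp_deriv h'.memLp_deriv,
    fun φ v => ?_⟩
  simp only [ContinuousAlternatingMap.add_apply, mul_add, Finset.sum_add_distrib]
  rw [integral_add (h.integrable_left φ v) (h'.integrable_left φ v),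
    integral_add (h.integrable_right φ v) (h'.integrable_right φ v),
    h.isWeakExtDeriv φ v, h'.isWeakExtDeriv φ v, neg_add]

theorem MemWdInfty.const_smul {ω : Eucl n → Form n p} {η : Eucl n → Form n (p + 1)}
    (h : MemWdInfty Ω ω η) (r : ℝ) :
    MemWdInfty Ω (fun x => r • ω x) (fun x => r • η x) := by
  refine ⟨h.memLp.const_smul r, h.memLp_deriv.const_smul r, fun φ v => ?_⟩
  simp only [ContinuousAlternatingMap.smul_apply, smul_eq_mul, mul_left_comm _ r,
    ← Finset.mul_sum]
  rw [integral_const_mul, integral_const_mul, h.isWeakExtDeriv φ v, mul_neg]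

/-- Every constant form of positive degree is exact. -/
theorem exists_memWdInfty_const (hΩ : Bornology.IsBounded (Ω : Set (Eucl n)))
    (ξ : Form n (p + 1)) : ∃ ω : Eucl n → Form n p, MemWdInfty Ω ω fun _ => ξ := by
  induction ξ using decomp_induction with
  | h u =>
    obtain ⟨β, hβ⟩ := exists_decomp_eq_wedgeOne u 0
    obtain ⟨C, hC⟩ := exists_lipschitzWith_dual (u 0)
    -- The potential of u₀ ∧ β is u₀(x) β, since the linear function u₀ has differential u₀; it is
    -- bounded because Ω is.
    refine ⟨fun x => u 0 x • β, ?_⟩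
    have h := memWdInfty_smul (s := fun _ => 1) hΩ hC (c := u 0)
      (Eventually.of_forall fun x v => by
        rw [one_mul]
        exact (LinearMap.toContinuousLinearMap (u 0)).hasFDerivAt.hasLineDerivAt v |>.lineDeriv)
      measurable_const (by simp) β
    simpa only [one_smul, ← hβ] using h
  | h0 => exact ⟨fun _ => 0, memLp_top_const 0, memLp_top_const 0, fun φ v => by simp⟩
  | hadd x y hx hy =>
    obtain ⟨ω, hω⟩ := hx
    obtain ⟨ω', hω'⟩ := hy
    exact ⟨_, hω.add hω'⟩
  | hsmul r x hx =>
    obtain ⟨ω, hω⟩ := hx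
    exact ⟨_, hω.const_smul r⟩

theorem exists_testFunction_integral_ne_zero (hΩ : (Ω : Set (Eucl n)).Nonempty) :
    ∃ φ : TestFunction Ω ℝ ⊤, ∫ x in (Ω : Set (Eucl n)), φ x ≠ 0 := by
  obtain ⟨x₀, hx₀⟩ := hΩ
  obtain ⟨r, hr, hball⟩ := Metric.isOpen_iff.1 Ω.isOpen x₀ hx₀
  let b : ContDiffBump x₀ := ⟨r / 4, r / 2, by linarith, by linarith⟩
  have hsub : tsupport b ⊆ (Ω : Set (Eucl n)) := by
    rw [b.tsupport_eq]
    exact (Metric.closedBall_subset_ball (by change r / 2 < r; linarith)).trans hball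
  refine ⟨⟨b, b.contDiff, b.hasCompactSupport, hsub⟩, ?_⟩
  change ∫ x in (Ω : Set (Eucl n)), b x ≠ 0
  rw [setIntegral_eq_integral_of_forall_compl_eq_zero fun x hx =>
    image_eq_zero_of_notMem_tsupport fun h => hx (hsub h)]
  exact b.integral_pos.ne'

theorem integrableOn_pairing (ζ : Form n p) {s : Set (Eucl n)} {g : Eucl n → Form n p}
    (hg : IntegrableOn g s) : IntegrableOn (fun x => pairing ζ (g x)) s :=
  (LinearMap.toContinuousLinearMap (pairingL n p ζ)).integrable_comp hg

end WeakDerivative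

/-! ### From weak continuity to affinity -/

section WeakContinuity

variable {n m p : ℕ} {Ω : Opens (Eucl n)}

theorem MeasureTheory.MemLp.integrable_pairing {ω g : Eucl n → Form n p}
    (hω : MemLp ω ∞ (volume.restrict (Ω : Set (Eucl n)))) (hg : IntegrableOn g Ω) :
    IntegrableOn (fun x => pairing (ω x) (g x)) Ω := by
  refine integrable_finsetSum _ fun J _ => ?_
  refine Integrable.mul_of_top_right ?_ (hω.form_apply _)
  let L : Form n p →ₗ[ℝ] ℝ :=
    { toFun := fun ζ => ζ fun i => EuclideanSpace.single (J i) 1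
      map_add' := fun _ _ => rfl
      map_smul' := fun _ _ => rfl }
  exact (LinearMap.toContinuousLinearMap L).integrable_comp hg

/-- Pairing with the fixed form β reduces the claim to scalar test functions. It serves both the
potentials and their derivatives. -/
theorem weakStarTendsto_add_smul {ω : Eucl n → Form n p}
    (hω : MemLp ω ∞ (volume.restrict (Ω : Set (Eucl n)))) {u : ℕ → Eucl n → ℝ}
    (hum : ∀ k, Measurable (u k)) (hub : ∀ k x, |u k x| ≤ 1)
    (hu : ∀ g : Eucl n → ℝ, IntegrableOn g Ω →
      Tendsto (fun k => ∫ x in (Ω : Set (Eucl n)), u k x * g x) atTop (𝓝 0))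
    (β : Form n p) :
    WeakStarTendsto Ω (fun k x => ω x + u k x • β) ω := by
  intro g hg
  have h1 := (hu _ (integrableOn_pairing β hg)).const_add
    (∫ x in (Ω : Set (Eucl n)), pairing (ω x) (g x))
  rw [add_zero] at h1
  refine h1.congr fun k => ?_
  rw [← integral_add (hω.integrable_pairing hg)
    ((integrableOn_pairing β hg).bdd_mul (c := 1) (hum k).aestronglyMeasurable
      (Eventually.of_forall fun x => hub k x))]
  refine integral_congr_ae (Eventually.of_forall fun x => ?_)
  simp only [← pairingL_apply, map_add, map_smul, LinearMap.add_apply, LinearMap.smul_apply,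
    smul_eq_mul]

theorem tendsto_setIntegral_oscPotential (c : Module.Dual ℝ (Eucl n)) {g : Eucl n → ℝ}
    (hg : IntegrableOn g Ω) :
    Tendsto (fun k => ∫ x in (Ω : Set (Eucl n)), oscPotential c k x * g x) atTop (𝓝 0) := by
  have hlim : Tendsto (fun k : ℕ => 1 / ((k : ℝ) + 1) * ∫ x in (Ω : Set (Eucl n)), ‖g x‖) atTop
      (𝓝 0) := by
    simpa using (tendsto_one_div_add_atTop_nhds_zero_nat (𝕜 := ℝ)).mul_const
      (∫ x in (Ω : Set (Eucl n)), ‖g x‖)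
  refine squeeze_zero_norm (fun k => ?_) hlim
  rw [← integral_const_mul]
  refine norm_integral_le_of_norm_le (hg.norm.const_mul _) (Eventually.of_forall fun x => ?_)
  rw [norm_mul]
  exact mul_le_mul_of_nonneg_right (abs_oscPotential_le c k x) (norm_nonneg _)

variable {l : Fin m → ℕ} {f : ((i : Fin m) → Form n (l i + 1)) → ℝ}

/-- Weak continuity forces midpoint affinity in all directions `a ∧ β`. -/
theorem WeaklyContinuousOnWdInfty.midpoint_eq (hΩ : (Ω : Set (Eucl n)).Nonempty)
    (hΩb : Bornology.IsBounded (Ω : Set (Eucl n))) (hf : WeaklyContinuousOnWdInfty Ω f)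
    (ξ : (i : Fin m) → Form n (l i + 1)) (a : Form n 1) (β : (i : Fin m) → Form n (l i)) :
    f ξ = (f (ξ + wedgeDir a β) + f (ξ - wedgeDir a β)) / 2 := by
  obtain ⟨c, rfl⟩ := exists_eq_decomp_one a
  -- A zero covector cannot drive an oscillation, but then the direction is 0 and the identity is
  -- trivial.
  by_cases hc : c = 0
  · have h0 : decomp n 1 (fun _ => c) = 0 := AlternatingMap.map_coord_zero _ 0 hc
    have : wedgeDir (decomp n 1 fun _ => c) β = 0 := by
      funext i
      apply toExt_injective
      simp only [wedgeDir]
      rw [toExt_wedgeOne, h0]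
      simp
    rw [this]
    simp
  choose ω₀ hω₀ using fun i => exists_memWdInfty_const (Ω := Ω) hΩb (ξ i)
  set η := wedgeDir (decomp n 1 fun _ => c) β with hη
  have hcc : Continuous c := c.continuous_of_finiteDimensional
  have hsm : ∀ k : ℕ, Measurable fun x => squareWave ((k + 1 : ℝ) * c x) := fun k =>
    measurable_squareWave.comp (hcc.measurable.const_mul _)
  have hsq : ∀ g : Eucl n → ℝ, IntegrableOn g Ω → Tendsto (fun k : ℕ =>
      ∫ x in (Ω : Set (Eucl n)), squareWave ((k + 1 : ℝ) * c x) * g x) atTop (𝓝 0) := fun g hg =>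
    tendsto_setIntegral_squareWave hc Ω.isOpen.measurableSet hg
  have hosc : ∀ k : ℕ, Measurable (oscPotential c k) := fun k => by
    obtain ⟨C, hC⟩ := exists_lipschitzWith_oscPotential c k
    exact hC.continuous.measurable
  obtain ⟨φ, hφ⟩ := exists_testFunction_integral_ne_zero hΩ
  have h1 := hf.2 (fun k i x => ω₀ i x + oscPotential c k x • β i)
    (fun k i x => ξ i + squareWave ((k + 1 : ℝ) * c x) • η i) ω₀ (fun i _ => ξ i)
    (fun k i => by
      obtain ⟨C, hC⟩ := exists_lipschitzWith_oscPotential c k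
      exact (hω₀ i).add (memWdInfty_smul hΩb hC (ae_lineDeriv_oscPotential hc k) (hsm k)
        (fun x => (abs_squareWave _).le) (β i)))
    hω₀
    (fun i => weakStarTendsto_add_smul (hω₀ i).memLp hosc
      (fun k x => (abs_oscPotential_le c k x).trans
        (by rw [div_le_one (by positivity)]; linarith [(Nat.cast_nonneg k : (0 : ℝ) ≤ k)]))
      (fun g hg => tendsto_setIntegral_oscPotential c hg) (β i))
    (fun i => weakStarTendsto_add_smul (hω₀ i).memLp_deriv hsm (fun k x => (abs_squareWave _).le)
      hsq (η i)) φ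
  -- Since the wave takes only the values ±1, the composition with `f` is an affine function of the
  -- wave, although `f` is nonlinear.
  have h2 : ∀ k : ℕ, ∀ x, φ x * f (fun i => ξ i + squareWave ((k + 1 : ℝ) * c x) • η i) =
      (f (ξ + η) + f (ξ - η)) / 2 * φ x + (f (ξ + η) - f (ξ - η)) / 2 *
        (squareWave ((k + 1 : ℝ) * c x) * φ x) := by
    intro k x
    have e1 : (fun i => ξ i + (1 : ℝ) • η i) = ξ + η := by funext i; simp
    have e2 : (fun i => ξ i + (-1 : ℝ) • η i) = ξ - η := by
      funext i; rw [neg_one_smul ℝ (η i), Pi.sub_apply, sub_eq_add_neg]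
    rcases squareWave_eq_or ((k + 1 : ℝ) * c x) with h | h
    · rw [h, e1]; ring
    · rw [h, e2]; ring
  have hφi : IntegrableOn φ (Ω : Set (Eucl n)) := φ.integrable_volume.restrict
  have h3 := ((hsq φ hφi).const_mul ((f (ξ + η) - f (ξ - η)) / 2)).const_add
    ((f (ξ + η) + f (ξ - η)) / 2 * ∫ x in (Ω : Set (Eucl n)), φ x)
  have h4 := tendsto_nhds_unique h1 (h3.congr fun k => by
    rw [integral_congr_ae (Eventually.of_forall (h2 k)), integral_add (hφi.const_mul _)
      ((hφi.bdd_mul (c := 1) (hsm k).aestronglyMeasurable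
        (Eventually.of_forall fun x => (abs_squareWave _).le)).const_mul _),
      integral_const_mul, integral_const_mul])
  rw [integral_mul_const, mul_comm, mul_zero, add_zero] at h4
  exact mul_right_cancel₀ hφ h4

theorem WeaklyContinuousOnWdInfty.vectoriallyExtOneAffine (hΩ : (Ω : Set (Eucl n)).Nonempty)
    (hΩb : Bornology.IsBounded (Ω : Set (Eucl n))) (hf : WeaklyContinuousOnWdInfty Ω f) :
    VectoriallyExtOneAffine f := by
  intro ξ a β
  let A : ℝ →ᵃ[ℝ] ℝ := AffineMap.ofMapMidpoint (fun t : ℝ => f (ξ + t • wedgeDir a β))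
    (fun s t => by
      -- Centred at the midpoint of s and t, the half-step (s - t)/2 reaches the points of the line
      -- with parameters s and t.
      have h := hf.midpoint_eq hΩ hΩb (ξ + midpoint ℝ s t • wedgeDir a β) a (((s - t) / 2) • β)
      rw [← smul_wedgeDir] at h
      have e1 : ξ + midpoint ℝ s t • wedgeDir a β + ((s - t) / 2) • wedgeDir a β =
          ξ + s • wedgeDir a β := by
        rw [midpoint_eq_smul_add, smul_eq_mul, add_assoc, ← add_smul]
        congr 2
        rw [invOf_eq_inv]; ring
      have e2 : ξ + midpoint ℝ s t • wedgeDir a β - ((s - t) / 2) • wedgeDir a β =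
          ξ + t • wedgeDir a β := by
        rw [midpoint_eq_smul_add, smul_eq_mul, invOf_eq_inv]
        module
      rw [e1, e2] at h
      rw [h, midpoint_eq_smul_add, smul_eq_mul, invOf_eq_inv]
      ring)
    (hf.1.comp (by fun_prop))
  refine ⟨A 0, A.linear 1, fun t => ?_⟩
  have h := A.map_vadd 0 t
  rw [vadd_eq_add, vadd_eq_add, add_zero] at h
  have h' : A.linear t = A.linear 1 * t := by
    have := A.linear.map_smul t 1
    rw [smul_eq_mul, smul_eq_mul, mul_one] at this
    rw [this, mul_comm]
  rw [h', add_comm] at h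
  exact h

end WeakContinuity

end

theorem mainTheorem5 {n m : ℕ} (hm : 1 ≤ m) (l : Fin m → ℕ) (hl : ∀ i, l i + 1 ≤ n)
    (Ω : TopologicalSpace.Opens (Eucl n)) (hΩ : (Ω : Set (Eucl n)).Nonempty)
    (hΩb : Bornology.IsBounded (Ω : Set (Eucl n)))
    (f : ((i : Fin m) → Form n (l i + 1)) → ℝ)
    (hf : WeaklyContinuousOnWdInfty Ω f) :
    VectoriallyExtOneAffine f ∧
      ∃ c : (α : Fin m → ℕ) → Form n (∑ i, (l i + 1) * α i),
        ∀ ξ : (i : Fin m) → Form n (l i + 1),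
          f ξ = ∑ α ∈ multiIndices n (fun i => l i + 1),
            Form.pairing (c α) (Form.wedgeMultiPow ξ α) :=
  have h := hf.vectoriallyExtOneAffine hΩ hΩb
  ⟨h, h.exists_eq_sum⟩
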